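/- Let $d\ge 1$. A cube is an axis-parallel cube in $\mathbb R^d$ of positive finite side length; $|x|$ is the Euclidean norm and $|A|$ the Lebesgue measure. For $u\in\{0,\tfrac13,\tfrac23\}^d$ let $\mathcal D^u:=\{2^{-j}([0,1)^d+m+(-1)^ju): j\in\mathbb Z,\ m\in\mathbb Z^d\}$, and for $Q\in\mathcal D^u$ and $k\in\mathbb N=\{0,1,2,\dots\}$ let $Q^{(k)}$ be the cube of $\mathcal D^u$ that contains $Q$ and whose side length is $2^k$ times that of $Q$. For $\mathcal S\subset\mathcal D^u$ and measurable $g\ge 0$ put $$A_{\mathcal S,k}\,g:=\sum_{Q\in\mathcal S}1_Q\,\frac1{|Q^{(k)}|}\int_{Q^{(k)}}g .$$ For $0<\nu<1$, a collection $\mathcal S$ of measurable sets is pairwise nearly disjoint with the parameter $\nu$ if there are measurable subsets $E(Q)\subset Q$, $Q\in\mathcal S$, with $|E(Q)|\ge\nu|Q|$ and $E(Q)\cap E(Q')=\emptyset$ whenever $Q\ne Q'$. Let $(E,\|\cdot\|)$ be a Banach space, $1<p<\infty$, $0<\alpha\le1$, and let $A,B$ be real constants. A linear operator $T:L^p(\mathbb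 R^d\to E)\to L^p(\mathbb R^d\to E)$ is called an $E$-valued Calderón–Zygmund operator with Hölder exponent $\alpha$ and constants $A,B$ if $\|T\|_{L^p\to L^p}\le A$ and there is a kernel $K:\{(x,y)\in\mathbb R^d\times\mathbb R^d: x\ne y\}\to B(E\to E)$ with values in the bounded linear operators on $E$ such that $$\|K(x,y)\|\le \frac{B}{|x-y|^{d}}\quad (x\ne y),$$ $$\|K(x,y)-K(x',y)\|\le B\Big(\frac{|x-x'|}{|x-y|}\Big)^{\alpha}\frac1{|x-y|^{d}}\quad (0<|x-x'|<\tfrac12|x-y|),$$ $$\|K(x,y)-K(x,y')\|\le B\Big(\frac{|y-y'|}{|x-y|}\Big)^{\alpha}\frac1{|x-y|^{d}}\quad (0<|y-y'|<\tfrac12|x-y|),$$ and, for every strongly measurable, bounded, compactly supported $f:\mathbb R^d\to E$, $Tf(x)=\int K(x,y)f(y)\,dy$ for almost every $x$ outside the support of $f$. Theorem. There are a parameter $\nu\in(0,1)$ depending only on $d$ and a constant $C>0$ depending only on $d,\alpha,A,B$ such that the following holds. Let $T$ be such an operator, let $f:\mathbb R^d\to E$ be strongly measurable, bounded and compactly supported,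 and let $Q^0$ be a cube that contains the support of $f$. Then for each $u\in\{0,\frac13,\frac23\}^d$ and each $k\in\mathbb N$ there is a collection $\mathcal S^u_k\subset\mathcal D^u$ that is pairwise nearly disjoint with the parameter $\nu$, such that for almost every $x\in\mathbb R^d$ $$1_{Q^0}(x)\,\|Tf(x)\|\le C\sum_{u\in\{0,\frac13,\frac23\}^d}\ \sum_{k=0}^\infty 2^{-\alpha k}\,\big(A_{\mathcal S^u_k,k}\|f\|\big)(x).$$ The collections may depend on $T$, $f$ and $Q^0$. -/

import Mathlib

open MeasureTheory Set
open scoped ENNReal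

namespace DyadicDomination

/-! ### Functions and operators -/

/-- Strongly measurable (with respect to Lebesgue measure), bounded and compactly supported
functions `ℝ^d → E`. -/
structure IsBddCompactlySupported {d : ℕ} {E : Type*} [NormedAddCommGroup E]
    (f : EuclideanSpace ℝ (Fin d) → E) : Prop where
  aestronglyMeasurable : AEStronglyMeasurable f volume
  bounded : ∃ M : ℝ, ∀ x, ‖f x‖ ≤ M
  hasCompactSupport : HasCompactSupport f

/-- Such functions belong to every Lebesgue-Bochner space. -/
theorem IsBddCompactlySupported.memLp {d : ℕ} {E : Type*} [NormedAddCommGroup E]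
    {f : EuclideanSpace ℝ (Fin d) → E} (hf : IsBddCompactlySupported f) (p : ℝ≥0∞) :
    MemLp f p volume := by
  obtain ⟨M, hM⟩ := hf.bounded
  have hs : MeasurableSet (tsupport f) := (isClosed_tsupport f).measurableSet
  have hfin : volume (tsupport f) < ∞ := IsCompact.measure_lt_top hf.hasCompactSupport
  have : IsFiniteMeasure (volume.restrict (tsupport f)) := ⟨by simpa using hfin⟩
  have h : MemLp f p (volume.restrict (tsupport f)) :=
    MemLp.of_bound hf.aestronglyMeasurable.restrict M (Filter.Eventually.of_forall hM)
  have h' := (memLp_indicator_iff_restrict hs).2 h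
  rwa [indicator_eq_self.2 (subset_tsupport f)] at h'

/-- `K` is a `B(E → E)`-valued singular kernel with Hölder exponent `α` and constant `B`:
the decay estimate and the two Hölder-type estimates. The values of `K` on the diagonal play
no role. -/
structure IsSingularKernel {d : ℕ} {E : Type*} [NormedAddCommGroup E] [NormedSpace ℝ E]
    (α B : ℝ) (K : EuclideanSpace ℝ (Fin d) → EuclideanSpace ℝ (Fin d) → (E →L[ℝ] E)) :
    Prop where
  decay : ∀ x y, x ≠ y → ‖K x y‖ ≤ B * (1 / ‖x - y‖ ^ d)
  holder_left : ∀ x x' y, 0 < ‖x - x'‖ → ‖x - x'‖ < 1 / 2 * ‖x - y‖ →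
    ‖K x y - K x' y‖ ≤ B * ((‖x - x'‖ / ‖x - y‖) ^ α * (1 / ‖x - y‖ ^ d))
  holder_right : ∀ x y y', 0 < ‖y - y'‖ → ‖y - y'‖ < 1 / 2 * ‖x - y‖ →
    ‖K x y - K x y'‖ ≤ B * ((‖y - y'‖ / ‖x - y‖) ^ α * (1 / ‖x - y‖ ^ d))

/-- The bounded linear operator `T` on `L^p(ℝ^d → E)` is a vector-valued Calderón-Zygmund
operator with Hölder exponent `α`, norm at most `A`, and a kernel with constant `B`. As `T f`
is a class of functions modulo null sets, the kernel representation is required at almost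
every point outside the support of `f`. -/
structure IsCalderonZygmund {d : ℕ} {E : Type*} [NormedAddCommGroup E] [NormedSpace ℝ E]
    {p : ℝ≥0∞} [Fact (1 ≤ p)] (α A B : ℝ)
    (T : Lp E p (volume : Measure (EuclideanSpace ℝ (Fin d))) →L[ℝ]
      Lp E p (volume : Measure (EuclideanSpace ℝ (Fin d)))) : Prop where
  norm_le : ‖T‖ ≤ A
  exists_kernel : ∃ K : EuclideanSpace ℝ (Fin d) → EuclideanSpace ℝ (Fin d) → (E →L[ℝ] E),
    IsSingularKernel α B K ∧
      ∀ (f : EuclideanSpace ℝ (Fin d) → E) (hf : IsBddCompactlySupported f),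
        ∀ᵐ x, x ∉ tsupport f → T ((hf.memLp p).toLp f) x = ∫ y, K x y (f y)

/-! ### Cubes -/

/-- The axis-parallel closed cube with corner `a` and side length `l`. -/
def closedCube {d : ℕ} (a : EuclideanSpace ℝ (Fin d)) (l : ℝ) :
    Set (EuclideanSpace ℝ (Fin d)) :=
  {x | ∀ i, a i ≤ x i ∧ x i ≤ a i + l}

/-- The cube `2^{-j} ([0,1)^d + m + (-1)^j u)`. The translation parameter, an element of
`{0, 1/3, 2/3}^d`, is given by `u : Fin d → Fin 3` and has the coordinates `(u i) / 3`. -/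
def dyadicCube {d : ℕ} (u : Fin d → Fin 3) (j : ℤ) (m : Fin d → ℤ) :
    Set (EuclideanSpace ℝ (Fin d)) :=
  {x | ∀ i, (2 : ℝ) ^ (-j) * (m i + (-1) ^ j * (((u i : ℕ) : ℝ) / 3)) ≤ x i ∧
    x i < (2 : ℝ) ^ (-j) * (m i + (-1) ^ j * (((u i : ℕ) : ℝ) / 3) + 1)}

/-- The translated dyadic system `𝒟^u`. -/
def dyadicSystem {d : ℕ} (u : Fin d → Fin 3) : Set (Set (EuclideanSpace ℝ (Fin d))) :=
  {Q | ∃ (j : ℤ) (m : Fin d → ℤ), Q = dyadicCube u j m}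

/-- The `k`-th ancestor of a cube `Q` of the system `𝒟^u`: the cube of `𝒟^u` that contains `Q`
and whose side length is `2^k` times that of `Q`. It is written as the union of all such cubes;
there is exactly one, see `dyadicAncestor_spec`. -/
def dyadicAncestor {d : ℕ} (u : Fin d → Fin 3) (k : ℕ) (Q : Set (EuclideanSpace ℝ (Fin d))) :
    Set (EuclideanSpace ℝ (Fin d)) :=
  ⋃₀ {R | ∃ (j : ℤ) (m n : Fin d → ℤ),
    Q = dyadicCube u j m ∧ R = dyadicCube u (j - k) n ∧ Q ⊆ R}

theorem dyadicCube_subset_parent {d : ℕ} (u : Fin d → Fin 3) (j : ℤ) (m : Fin d → ℤ) :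
    ∃ n, dyadicCube u j m ⊆ dyadicCube u (j - 1) n := by
  obtain ⟨s, hs⟩ : ∃ s : ℤ, (-1 : ℝ) ^ j = s := by
    rcases Int.even_or_odd j with h | h
    · exact ⟨1, by simp [h.neg_one_zpow]⟩
    · exact ⟨-1, by simp [h.neg_one_zpow]⟩
  refine ⟨fun i => (m i + s * (u i : ℕ)) / 2, fun x hx i => ?_⟩
  have h2 : (2 : ℝ) ^ (-(j - 1)) = 2 * 2 ^ (-j) := by
    rw [neg_sub, sub_eq_add_neg, zpow_add₀ two_ne_zero, zpow_one]
  have h1 : (-1 : ℝ) ^ (j - 1) = -s := by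
    rw [zpow_sub₀ (by norm_num), hs, zpow_one, div_neg, div_one]
  have hpos : (0 : ℝ) < 2 ^ (-j) := by positivity
  have hxi := hx i
  rw [hs] at hxi
  rw [h2, h1]
  generalize (2 : ℝ) ^ (-j) = t at *
  have e1 : (2 : ℝ) * (((m i + s * (u i : ℕ)) / 2 : ℤ) : ℝ) ≤ m i + s * (u i : ℕ) := by
    have : 2 * ((m i + s * ((u i : ℕ) : ℤ)) / 2) ≤ m i + s * ((u i : ℕ) : ℤ) := by omega
    exact_mod_cast this
  have e2 : (m i : ℝ) + s * (u i : ℕ) ≤ 2 * (((m i + s * (u i : ℕ)) / 2 : ℤ) : ℝ) + 1 := by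
    have : m i + s * ((u i : ℕ) : ℤ) ≤ 2 * ((m i + s * ((u i : ℕ) : ℤ)) / 2) + 1 := by omega
    exact_mod_cast this
  have f1 := mul_le_mul_of_nonneg_left e1 hpos.le
  have f2 := mul_le_mul_of_nonneg_left e2 hpos.le
  constructor
  · refine le_trans ?_ hxi.1
    linarith
  · refine lt_of_lt_of_le hxi.2 ?_
    linarith

theorem dyadicCube_subset_ancestor {d : ℕ} (u : Fin d → Fin 3) (k : ℕ) (j : ℤ)
    (m : Fin d → ℤ) : ∃ n, dyadicCube u j m ⊆ dyadicCube u (j - k) n := by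
  induction k with
  | zero => exact ⟨m, by simp⟩
  | succ k ih =>
    obtain ⟨n, hn⟩ := ih
    obtain ⟨n', hn'⟩ := dyadicCube_subset_parent u (j - k) n
    refine ⟨n', hn.trans ?_⟩
    have : j - ((k + 1 : ℕ) : ℤ) = j - k - 1 := by push_cast; ring
    rwa [this]

theorem dyadicCube_nonempty {d : ℕ} (u : Fin d → Fin 3) (j : ℤ) (m : Fin d → ℤ) :
    (dyadicCube u j m).Nonempty := by
  refine ⟨WithLp.toLp 2
    fun i => (2 : ℝ) ^ (-j) * (m i + (-1) ^ j * (((u i : ℕ) : ℝ) / 3)), fun i => ?_⟩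
  have : (0 : ℝ) < 2 ^ (-j) := by positivity
  exact ⟨le_rfl, by simp only; nlinarith⟩

/-- Cubes of the same generation that meet are equal. -/
theorem dyadicCube_index_unique {d : ℕ} {u : Fin d → Fin 3} {j : ℤ} {m n : Fin d → ℤ}
    {x : EuclideanSpace ℝ (Fin d)} (hm : x ∈ dyadicCube u j m) (hn : x ∈ dyadicCube u j n) :
    m = n := by
  funext i
  have hpos : (0 : ℝ) < 2 ^ (-j) := by positivity
  have a := lt_of_mul_lt_mul_left ((hm i).1.trans_lt (hn i).2) hpos.le
  have b := lt_of_mul_lt_mul_left ((hn i).1.trans_lt (hm i).2) hpos.le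
  have a' : (m i : ℝ) < n i + 1 := by linarith
  have b' : (n i : ℝ) < m i + 1 := by linarith
  have a'' : m i < n i + 1 := by exact_mod_cast a'
  have b'' : n i < m i + 1 := by exact_mod_cast b'
  omega

/-- In positive dimension an inclusion of cubes is monotone in the side length. -/
theorem dyadicCube_gen_le {d : ℕ} (hd : 0 < d) {u : Fin d → Fin 3} {j j' : ℤ}
    {m m' : Fin d → ℤ} (h : dyadicCube u j m ⊆ dyadicCube u j' m') : j' ≤ j := by
  by_contra! hlt
  obtain ⟨c, hc⟩ : ∃ c : Fin d → ℝ,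
      c = fun i => (2 : ℝ) ^ (-j) * (m i + (-1) ^ j * (((u i : ℕ) : ℝ) / 3)) := ⟨_, rfl⟩
  have hpos : (0 : ℝ) < 2 ^ (-j) := by positivity
  have hpos' : (0 : ℝ) < 2 ^ (-j') := by positivity
  have hl : (2 : ℝ) ^ (-j') < 2 ^ (-j) := zpow_lt_zpow_right₀ (by norm_num) (by omega)
  have hmem : ∀ t : ℝ, 0 ≤ t → t < 2 ^ (-j) →
      (WithLp.toLp 2 fun i => c i + t : EuclideanSpace ℝ (Fin d)) ∈ dyadicCube u j m := by
    intro t ht ht' i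
    simp only [hc]
    constructor <;> linarith
  have p0 := h (hmem 0 le_rfl hpos) ⟨0, hd⟩
  have p1 := h (hmem (2 ^ (-j')) hpos'.le hl) ⟨0, hd⟩
  simp only at p0 p1
  linarith [p0.1, p1.2]

/-- In positive dimension, each cube of `𝒟^u` has a unique `k`-th ancestor. -/
theorem dyadicAncestor_spec {d : ℕ} (hd : 0 < d) (u : Fin d → Fin 3) (k : ℕ) (j : ℤ)
    (m n : Fin d → ℤ) : dyadicAncestor u k (dyadicCube u j m) = dyadicCube u (j - k) n ↔
      dyadicCube u j m ⊆ dyadicCube u (j - k) n := by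
  have key : ∀ n, dyadicCube u j m ⊆ dyadicCube u (j - k) n →
      dyadicAncestor u k (dyadicCube u j m) = dyadicCube u (j - k) n := by
    intro n hn
    apply Subset.antisymm
    · rintro x ⟨R, ⟨j', m', n', hQ, rfl, hR⟩, hx⟩
      have hj : j' = j :=
        le_antisymm (dyadicCube_gen_le hd hQ.le) (dyadicCube_gen_le hd hQ.ge)
      subst hj
      obtain ⟨y, hy⟩ := dyadicCube_nonempty u j' m
      rwa [dyadicCube_index_unique (hn hy) (hR hy)]
    · exact fun x hx => ⟨_, ⟨j, m, n, rfl, rfl, hn⟩, hx⟩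
  refine ⟨fun h => ?_, key n⟩
  obtain ⟨n', hn'⟩ := dyadicCube_subset_ancestor u k j m
  rw [← h, key n' hn']
  exact hn'

/-! ### Nearly disjoint collections and dyadic model operators -/

/-- A collection `S` of measurable sets is pairwise nearly disjoint with the parameter `ν`. -/
def PairwiseNearlyDisjoint {d : ℕ} (ν : ℝ) (S : Set (Set (EuclideanSpace ℝ (Fin d)))) : Prop :=
  (∀ Q ∈ S, MeasurableSet Q) ∧
    ∃ F : Set (EuclideanSpace ℝ (Fin d)) → Set (EuclideanSpace ℝ (Fin d)),
      (∀ Q ∈ S, MeasurableSet (F Q) ∧ F Q ⊆ Q ∧ ENNReal.ofReal ν * volume Q ≤ volume (F Q)) ∧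
      ∀ Q ∈ S, ∀ Q' ∈ S, Q ≠ Q' → F Q ∩ F Q' = ∅

/-- The dyadic model operator `A_{S,k} g = ∑_{Q ∈ S} 1_Q ⨍_{Q^(k)} g` for a collection `S` of
cubes of the system `𝒟^u` and a nonnegative function `g`. -/
noncomputable def dyadicModel {d : ℕ} (u : Fin d → Fin 3)
    (S : Set (Set (EuclideanSpace ℝ (Fin d)))) (k : ℕ)
    (g : EuclideanSpace ℝ (Fin d) → ℝ≥0∞) (x : EuclideanSpace ℝ (Fin d)) : ℝ≥0∞ :=
  ∑' Q : S, (Q : Set (EuclideanSpace ℝ (Fin d))).indicator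
    (fun _ => ⨍⁻ y in dyadicAncestor u k Q, g y ∂volume) x

end DyadicDomination

open DyadicDomination

/-! The terms with `k = 0` already suffice: `T f` is dominated pointwise by a sparse sum of averages
of `‖f‖` (`IsCalderonZygmund.sparse_domination`). All later collections can be empty, so the decay
`2^{-αk}` is never used to sum over complexities. The Hölder exponent enters only through convergent
tail integrals of the kernel.

The analytic input is the weak (1,1) bound `IsCalderonZygmund.weak_type`, derived from the `L^p`
bound by a Calderón–Zygmund decomposition. Its constants do not involve `p`.

The core is `IsCalderonZygmund.local_step`. Given a dyadic cube `Q`, localize `f` to a ball `Q*`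
around it and call the result `F`. By the weak type bounds for `T` and for the dyadic maximal
functions of all translated systems, both `T F` and these maximal functions are at most a constant
times the average of `‖f‖` over `Q*`, except on a set `Ω` that is small compared with `Q`. Stopping
cubes of the indicator of `Ω` cover `Ω ∩ Q` up to a null set, take up at most half of `Q`, and are
each at least half outside `Ω`.

On a stopping cube `P`, the part of `F` outside `P*` contributes to `T F` a function that is
constant up to an error controlled by the averages of `‖F‖` over balls around `P`. A point of `P`
outside the exceptional sets bounds both these averages and the constant. Hence `T F` on `P` is at
most a multiple of the average over `Q*` plus the operator applied to `f` localized to `P*`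
(`IsCalderonZygmund.ae_enorm_le_add_local`).

Iterating inside the stopping cubes gives a tree whose layers halve in measure, so almost every
point leaves it after finitely many steps, and the recursive bounds add up to a sum over the
selected cubes containing the point. The parts of the cubes left uncovered by their children are
disjoint and have at least half the measure. The one-third trick replaces each ball `P*` by a cube
of some translated system of comparable size, at the cost of a smaller sparseness parameter. -/

namespace DyadicDomination

open Filter Topology Metric

/-! ### Geometry of dyadic cubes -/

/-- The lower corner of a dyadic cube. -/
noncomputable def dyadicCorner {d : ℕ} (u : Fin d → Fin 3) (j : ℤ) (m : Fin d → ℤ) :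
    EuclideanSpace ℝ (Fin d) :=
  WithLp.toLp 2 fun i => (2 : ℝ) ^ (-j) * (m i + (-1) ^ j * (((u i : ℕ) : ℝ) / 3))

theorem dyadicCorner_mem {d : ℕ} (u : Fin d → Fin 3) (j : ℤ) (m : Fin d → ℤ) :
    dyadicCorner u j m ∈ dyadicCube u j m := by
  intro i
  have : (0 : ℝ) < 2 ^ (-j) := by positivity
  exact ⟨le_rfl, by simp only [dyadicCorner]; nlinarith⟩

theorem dyadicCube_eq_preimage {d : ℕ} (u : Fin d → Fin 3) (j : ℤ) (m : Fin d → ℤ) :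
    dyadicCube u j m = (fun x : EuclideanSpace ℝ (Fin d) => (WithLp.ofLp x)) ⁻¹'
      (univ.pi fun i => Ico (dyadicCorner u j m i) (dyadicCorner u j m i + 2 ^ (-j))) := by
  ext x
  simp only [dyadicCube, mem_ofPred_eq, mem_preimage, Set.mem_pi, mem_univ, true_implies, mem_Ico,
    dyadicCorner]
  refine forall_congr' fun i => and_congr_right fun _ => ?_
  rw [mul_add _ _ (1 : ℝ), mul_one]

theorem measurableSet_dyadicCube {d : ℕ} (u : Fin d → Fin 3) (j : ℤ) (m : Fin d → ℤ) :
    MeasurableSet (dyadicCube u j m) := by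
  rw [dyadicCube_eq_preimage]
  exact (PiLp.volume_preserving_ofLp (Fin d)).measurable
    (MeasurableSet.univ_pi fun i => measurableSet_Ico)

theorem volume_dyadicCube {d : ℕ} (u : Fin d → Fin 3) (j : ℤ) (m : Fin d → ℤ) :
    volume (dyadicCube u j m) = ENNReal.ofReal (((2 : ℝ) ^ (-j)) ^ d) := by
  rw [dyadicCube_eq_preimage, (PiLp.volume_preserving_ofLp (Fin d)).measure_preimage
    (MeasurableSet.univ_pi fun i => measurableSet_Ico).nullMeasurableSet, Real.volume_pi_Ico]
  simp only [add_sub_cancel_left, Finset.prod_const, Finset.card_univ, Fintype.card_fin]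
  rw [ENNReal.ofReal_pow (by positivity)]

theorem volume_dyadicCube_ne_zero {d : ℕ} (u : Fin d → Fin 3) (j : ℤ) (m : Fin d → ℤ) :
    volume (dyadicCube u j m) ≠ 0 := by
  rw [volume_dyadicCube]
  have : (0 : ℝ) < ((2 : ℝ) ^ (-j)) ^ d := by positivity
  simpa using this

theorem volume_dyadicCube_ne_top {d : ℕ} (u : Fin d → Fin 3) (j : ℤ) (m : Fin d → ℤ) :
    volume (dyadicCube u j m) ≠ ∞ := by
  rw [volume_dyadicCube]
  exact ENNReal.ofReal_ne_top

theorem volume_dyadicCube_sub {d : ℕ} (u u' : Fin d → Fin 3) (j : ℤ) (k : ℕ) (m n : Fin d → ℤ) :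
    volume (dyadicCube u (j - k) n) = (2 ^ k) ^ d * volume (dyadicCube u' j m) := by
  rw [volume_dyadicCube, volume_dyadicCube]
  have : (2 : ℝ) ^ (-(j - k)) = 2 ^ k * 2 ^ (-j) := by
    rw [neg_sub, sub_eq_add_neg, zpow_add₀ two_ne_zero, zpow_natCast]
  rw [this, mul_pow, ENNReal.ofReal_mul (by positivity), ENNReal.ofReal_pow (by positivity),
    ENNReal.ofReal_pow (by positivity)]
  simp

theorem exists_mem_dyadicCube {d : ℕ} (u : Fin d → Fin 3) (j : ℤ) (x : EuclideanSpace ℝ (Fin d)) :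
    ∃ m, x ∈ dyadicCube u j m := by
  have h0 : (0 : ℝ) < 2 ^ (-j) := by positivity
  refine ⟨fun i => ⌊x i / 2 ^ (-j) - (-1) ^ j * (((u i : ℕ) : ℝ) / 3)⌋, fun i => ?_⟩
  have h1 := Int.floor_le (x i / 2 ^ (-j) - (-1) ^ j * (((u i : ℕ) : ℝ) / 3))
  have h2 := Int.lt_floor_add_one (x i / 2 ^ (-j) - (-1) ^ j * (((u i : ℕ) : ℝ) / 3))
  constructor
  · rw [mul_comm, ← le_div_iff₀ h0]; linarith
  · rw [mul_comm, ← div_lt_iff₀ h0]; linarith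

/-- The ancestor of the smaller cube in generation `j'` also contains `x`, and cubes of one
generation are disjoint. This is the nestedness of each translated system. -/
theorem dyadicCube_subset_of_le {d : ℕ} {u : Fin d → Fin 3} {j j' : ℤ} {m m' : Fin d → ℤ}
    {x : EuclideanSpace ℝ (Fin d)} (hx : x ∈ dyadicCube u j m) (hx' : x ∈ dyadicCube u j' m')
    (hj : j' ≤ j) : dyadicCube u j m ⊆ dyadicCube u j' m' := by
  obtain ⟨n, hn⟩ := dyadicCube_subset_ancestor u (j - j').toNat j m
  have : j - ((j - j').toNat : ℤ) = j' := by omega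
  rw [this] at hn
  rwa [dyadicCube_index_unique hx' (hn hx)]

theorem abs_sub_le_of_mem_dyadicCube {d : ℕ} {u : Fin d → Fin 3} {j : ℤ} {m : Fin d → ℤ}
    {x y : EuclideanSpace ℝ (Fin d)} (hx : x ∈ dyadicCube u j m) (hy : y ∈ dyadicCube u j m)
    (i : Fin d) : |x i - y i| ≤ 2 ^ (-j) := by
  have h1 := hx i
  have h2 := hy i
  rw [mul_add _ _ (1 : ℝ), mul_one] at h1 h2
  rw [abs_le]
  constructor <;> linarith [h1.1, h1.2, h2.1, h2.2]

/-- An upper bound for the diameter of a dyadic cube of generation `j`. -/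
noncomputable def dyadicRadius (d : ℕ) (j : ℤ) : ℝ := d * 2 ^ (-j)

theorem dyadicRadius_pos {d : ℕ} (hd : 0 < d) (j : ℤ) : 0 < dyadicRadius d j := by
  unfold dyadicRadius; positivity

theorem dist_le_dyadicRadius {d : ℕ} {u : Fin d → Fin 3} {j : ℤ} {m : Fin d → ℤ}
    {x y : EuclideanSpace ℝ (Fin d)} (hx : x ∈ dyadicCube u j m) (hy : y ∈ dyadicCube u j m) :
    dist x y ≤ dyadicRadius d j := by
  rw [EuclideanSpace.dist_eq, dyadicRadius]
  refine Real.sqrt_le_iff.2 ⟨by positivity, ?_⟩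
  calc ∑ i, dist (x i) (y i) ^ 2 ≤ ∑ i : Fin d, ((2 : ℝ) ^ (-j)) ^ 2 := by
        refine Finset.sum_le_sum fun i _ => ?_
        rw [Real.dist_eq]
        exact pow_le_pow_left₀ (abs_nonneg _) (abs_sub_le_of_mem_dyadicCube hx hy i) 2
    _ = d * ((2 : ℝ) ^ (-j)) ^ 2 := by simp
    _ ≤ (d * 2 ^ (-j)) ^ 2 := by
        rw [mul_pow]
        have : (d : ℝ) ≤ (d : ℝ) ^ 2 := by exact_mod_cast Nat.le_self_pow two_ne_zero d
        gcongr

theorem dyadicCube_subset_closedBall {d : ℕ} {u : Fin d → Fin 3} {j : ℤ} {m : Fin d → ℤ}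
    {y : EuclideanSpace ℝ (Fin d)} (hy : y ∈ dyadicCube u j m) :
    dyadicCube u j m ⊆ closedBall y (dyadicRadius d j) :=
  fun _ hx => dist_le_dyadicRadius hx hy

/-- The one-third trick in one dimension. -/
theorem exists_third_shift (s : ℤ) (hs : s = 1 ∨ s = -1) (a : ℝ) :
    ∃ (v : Fin 3) (n : ℤ), (n : ℝ) + s * (((v : ℕ) : ℝ) / 3) ≤ a ∧
      a + 1 / 3 < n + s * (((v : ℕ) : ℝ) / 3) + 1 := by
  have h1 := Int.floor_le (3 * a)
  have h2 := Int.lt_floor_add_one (3 * a)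
  -- The residue of `⌊3a⌋` modulo 3 selects the shift. For `s = -1` the shifts 1 and 2 change
  -- places, and the integer part goes up by one.
  obtain ⟨v, n, hv⟩ : ∃ (v : Fin 3) (n : ℤ), ⌊3 * a⌋ = 3 * n + s * ((v : ℕ) : ℤ) := by
    have : ⌊3 * a⌋ = 3 * (⌊3 * a⌋ / 3) + ⌊3 * a⌋ % 3 := (Int.mul_ediv_add_emod _ _).symm
    have h3 : ⌊3 * a⌋ % 3 = 0 ∨ ⌊3 * a⌋ % 3 = 1 ∨ ⌊3 * a⌋ % 3 = 2 := by omega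
    rcases hs with rfl | rfl <;> rcases h3 with h | h | h
    · exact ⟨0, ⌊3 * a⌋ / 3, by simp; omega⟩
    · exact ⟨1, ⌊3 * a⌋ / 3, by simp; omega⟩
    · exact ⟨2, ⌊3 * a⌋ / 3, by simp; omega⟩
    · exact ⟨0, ⌊3 * a⌋ / 3, by simp; omega⟩
    · exact ⟨2, ⌊3 * a⌋ / 3 + 1, by simp; omega⟩
    · exact ⟨1, ⌊3 * a⌋ / 3 + 1, by simp; omega⟩
  have hv' : (⌊3 * a⌋ : ℝ) = 3 * n + s * ((v : ℕ) : ℝ) := by exact_mod_cast hv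
  rw [hv'] at h1 h2
  exact ⟨v, n, by linarith, by linarith⟩

/-- The one-third trick: a set of diameter less than a third of the side length is contained in
a cube of one of the translated systems. -/
theorem exists_dyadicCube_superset {d : ℕ} (c : EuclideanSpace ℝ (Fin d)) (ρ : ℝ) (j : ℤ)
    (h : 6 * ρ < 2 ^ (-j)) :
    ∃ u m, {y : EuclideanSpace ℝ (Fin d) | ∀ i, |y i - c i| ≤ ρ} ⊆ dyadicCube u j m := by
  obtain ⟨s, hs, hsj⟩ : ∃ s : ℤ, (s = 1 ∨ s = -1) ∧ (-1 : ℝ) ^ j = s := by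
    rcases Int.even_or_odd j with h | h
    · exact ⟨1, by simp, by simp [h.neg_one_zpow]⟩
    · exact ⟨-1, by simp, by simp [h.neg_one_zpow]⟩
  have h0 : (0 : ℝ) < 2 ^ (-j) := by positivity
  choose v n hvn using fun i => exists_third_shift s hs ((c i - ρ) / 2 ^ (-j))
  refine ⟨v, n, fun y hy i => ?_⟩
  have hyi := abs_le.1 (hy i)
  rw [hsj, ← le_div_iff₀' h0, ← div_lt_iff₀' h0]
  constructor
  · refine (hvn i).1.trans ?_
    gcongr
    linarith
  · refine lt_of_le_of_lt ?_ (hvn i).2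
    rw [div_add' _ _ _ h0.ne']
    gcongr
    linarith

theorem exists_dyadicCube_superset_closedBall {d : ℕ} (c : EuclideanSpace ℝ (Fin d)) (ρ : ℝ)
    (j : ℤ) (h : 6 * ρ < 2 ^ (-j)) : ∃ u m, closedBall c ρ ⊆ dyadicCube u j m := by
  obtain ⟨u, m, hum⟩ := exists_dyadicCube_superset c ρ j h
  refine ⟨u, m, fun y hy => hum fun i => ?_⟩
  have := PiLp.norm_apply_le (y - c) i
  rw [mem_closedBall, dist_eq_norm] at hy
  exact this.trans hy

/-- Choosing the side length as the least power of two above `6ρ` keeps it within twice that number.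
The system cannot be prescribed, which is why maximal functions of all systems have to be controlled
later. -/
theorem exists_dyadicCube_superset_closedBall' {d : ℕ} (c : EuclideanSpace ℝ (Fin d)) {ρ : ℝ}
    (hρ : 0 < ρ) : ∃ u j m, closedBall c ρ ⊆ dyadicCube u j m ∧ (2 : ℝ) ^ (-j) ≤ 12 * ρ := by
  obtain ⟨n, hn⟩ := exists_mem_Ico_zpow (show 0 < 6 * ρ by positivity) one_lt_two
  obtain ⟨u, m, h⟩ := exists_dyadicCube_superset_closedBall c ρ (-(n + 1))
    (by rw [neg_neg]; exact hn.2)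
  refine ⟨u, _, m, h, ?_⟩
  rw [neg_neg, zpow_add₀ two_ne_zero, zpow_one]
  linarith [hn.1]

theorem closedCube_subset_dyadicCube {d : ℕ} (a : EuclideanSpace ℝ (Fin d)) {l : ℝ} (hl : 0 < l) :
    ∃ u j m, closedCube a l ⊆ dyadicCube u j m := by
  obtain ⟨n, hn⟩ := exists_mem_Ico_zpow (show 0 < 6 * l by positivity) one_lt_two
  obtain ⟨u, m, h⟩ := exists_dyadicCube_superset a l (-(n + 1)) (by rw [neg_neg]; exact hn.2)
  refine ⟨u, _, m, fun y hy => h fun i => ?_⟩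
  have := hy i
  rw [abs_le]
  constructor <;> linarith [this.1, this.2]

/-! ### Differentiation along dyadic cubes -/

/-- At a Lebesgue point the averages over shrinking cubes containing `x` converge, because each cube
lies in a ball around `x` of comparable measure. The null set does not depend on `τ`. -/
theorem ae_enorm_le_of_forall_dyadicCube {d : ℕ} (hd : 0 < d) {F : Type*} [NormedAddCommGroup F]
    {f : EuclideanSpace ℝ (Fin d) → F} (hf : Integrable f volume) (u : Fin d → Fin 3) :
    ∀ᵐ x, ∀ τ : ℝ≥0∞, (∀ j m, x ∈ dyadicCube u j m →
      ∫⁻ y in dyadicCube u j m, ‖f y‖ₑ ≤ τ * volume (dyadicCube u j m)) → ‖f x‖ₑ ≤ τ := by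
  have key := VitaliFamily.ae_tendsto_lintegral_enorm_sub_div
    (IsUnifLocDoublingMeasure.vitaliFamily (volume : Measure (EuclideanSpace ℝ (Fin d))) 1)
    hf.locallyIntegrable
  filter_upwards [key] with x hx τ hτ
  have hδ : Tendsto (fun n : ℕ => dyadicRadius d n) atTop (𝓝[>] 0) := by
    refine tendsto_nhdsWithin_iff.2 ⟨?_, Eventually.of_forall fun n => dyadicRadius_pos hd _⟩
    have h := (tendsto_pow_atTop_nhds_zero_of_lt_one (r := (1 / 2 : ℝ)) (by norm_num)
      (by norm_num)).const_mul (d : ℝ)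
    rw [mul_zero] at h
    refine h.congr fun n => ?_
    rw [dyadicRadius, zpow_neg, zpow_natCast, one_div, inv_pow]
  have hball := IsUnifLocDoublingMeasure.tendsto_closedBall_filterAt
    (volume : Measure (EuclideanSpace ℝ (Fin d))) (K := 1) (x := x) (fun _ : ℕ => x) _ hδ
    (Eventually.of_forall fun n => mem_closedBall_self (by
      rw [one_mul]; exact (dyadicRadius_pos hd _).le))
  have hlim := hx.comp hball
  -- The fixed ratio between the measures of the ball of radius `dyadicRadius` and of the cube;
  -- passing from balls to cubes costs this factor.
  set κ : ℝ≥0∞ := ENNReal.ofReal ((d : ℝ) ^ d) * volume (ball (0 : EuclideanSpace ℝ (Fin d)) 1)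
  have hκ : κ ≠ ∞ := ENNReal.mul_ne_top ENNReal.ofReal_ne_top measure_ball_lt_top.ne
  have hlim' := (ENNReal.Tendsto.const_mul hlim (Or.inr hκ)).const_add τ
  rw [mul_zero, add_zero] at hlim'
  refine ge_of_tendsto hlim' (Eventually.of_forall fun n => ?_)
  obtain ⟨m, hm⟩ := exists_mem_dyadicCube u n x
  have hsub := dyadicCube_subset_closedBall hm
  have hvol : volume (closedBall x (dyadicRadius d n)) = κ * volume (dyadicCube u n m) := by
    rw [Measure.addHaar_closedBall _ _ (dyadicRadius_pos hd _).le, volume_dyadicCube,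
      finrank_euclideanSpace_fin, dyadicRadius, mul_pow, ENNReal.ofReal_mul (by positivity)]
    simp only [κ]
    ring
  have h0 := volume_dyadicCube_ne_zero u n m
  have ht := volume_dyadicCube_ne_top u n m
  have hκ0 : κ ≠ 0 := by
    intro h
    rw [h, zero_mul] at hvol
    exact (measure_closedBall_pos volume x (dyadicRadius_pos hd n)).ne' hvol
  have h1 : ‖f x‖ₑ * volume (dyadicCube u n m) ≤ τ * volume (dyadicCube u n m) +
      ∫⁻ y in closedBall x (dyadicRadius d n), ‖f y - f x‖ₑ := by
    calc ‖f x‖ₑ * volume (dyadicCube u n m) = ∫⁻ y in dyadicCube u n m, ‖f x‖ₑ := by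
          rw [setLIntegral_const]
      _ ≤ ∫⁻ y in dyadicCube u n m, (‖f y‖ₑ + ‖f y - f x‖ₑ) := by
          refine lintegral_mono fun y => ?_
          calc ‖f x‖ₑ = ‖f y - (f y - f x)‖ₑ := by rw [sub_sub_cancel]
            _ ≤ _ := enorm_sub_le
      _ = (∫⁻ y in dyadicCube u n m, ‖f y‖ₑ) + ∫⁻ y in dyadicCube u n m, ‖f y - f x‖ₑ :=
          lintegral_add_left' hf.1.enorm.restrict _
      _ ≤ _ := add_le_add (hτ n m hm) (lintegral_mono_set hsub)
  have h2 : ‖f x‖ₑ ≤ (τ * volume (dyadicCube u n m) +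
      ∫⁻ y in closedBall x (dyadicRadius d n), ‖f y - f x‖ₑ) / volume (dyadicCube u n m) :=
    (ENNReal.le_div_iff_mul_le (Or.inl h0) (Or.inl ht)).2 h1
  refine h2.trans ?_
  rw [ENNReal.add_div, ENNReal.mul_div_cancel_right h0 ht]
  simp only [Function.comp_apply, hvol]
  rw [div_eq_mul_inv, div_eq_mul_inv, ENNReal.mul_inv (Or.inl hκ0) (Or.inl hκ)]
  have h3 : ∀ a b : ℝ≥0∞, κ * (a * (κ⁻¹ * b)) = a * b := fun a b => by
    rw [mul_left_comm, ← mul_assoc κ, ENNReal.mul_inv_cancel hκ0 hκ, one_mul]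
  rw [h3]

/-! ### Stopping cubes -/

/-- The maximal cubes of `𝒟^u` on which the average of `‖f‖` exceeds `τ`, with their standard
properties. -/
structure IsStoppingFamily {d : ℕ} {F : Type*} [NormedAddCommGroup F]
    (f : EuclideanSpace ℝ (Fin d) → F) (u : Fin d → Fin 3) (τ : ℝ≥0∞)
    (P : Set (ℤ × (Fin d → ℤ))) : Prop where
  disjoint : P.PairwiseDisjoint fun i => dyadicCube u i.1 i.2
  lt : ∀ i ∈ P, τ * volume (dyadicCube u i.1 i.2) < ∫⁻ y in dyadicCube u i.1 i.2, ‖f y‖ₑ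
  le : ∀ i ∈ P, ∫⁻ y in dyadicCube u i.1 i.2, ‖f y‖ₑ ≤
    2 ^ d * (τ * volume (dyadicCube u i.1 i.2))
  maximal : ∀ j m, τ * volume (dyadicCube u j m) < ∫⁻ y in dyadicCube u j m, ‖f y‖ₑ →
    ∃ i ∈ P, dyadicCube u j m ⊆ dyadicCube u i.1 i.2
  ae_le : ∀ᵐ x, (∀ i ∈ P, x ∉ dyadicCube u i.1 i.2) → ‖f x‖ₑ ≤ τ

/-- A cube with a large average of an integrable function has measure below `I / τ`. This bounds the
size of the stopping candidates, so that maximal ones exist. -/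
theorem exists_gen_lower_bound {d : ℕ} (hd : 0 < d) {I τ : ℝ≥0∞} (hI : I ≠ ∞) (hτ : τ ≠ 0)
    (hτ' : τ ≠ ∞) :
    ∃ b : ℤ, ∀ (u : Fin d → Fin 3) j m, τ * volume (dyadicCube u j m) < I → b ≤ j := by
  obtain ⟨N, hN⟩ := ENNReal.exists_nat_gt (ENNReal.div_ne_top hI hτ)
  refine ⟨-N, fun u j m h => ?_⟩
  by_contra! hj
  have h1 : volume (dyadicCube u j m) < I / τ := by
    rwa [ENNReal.lt_div_iff_mul_lt (Or.inl hτ) (Or.inl hτ'), mul_comm]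
  refine absurd (h1.trans hN) (not_lt.2 ?_)
  rw [volume_dyadicCube, ← ENNReal.ofReal_natCast]
  refine ENNReal.ofReal_le_ofReal ?_
  have h2 : (N : ℝ) ≤ 2 ^ (-j) := by
    calc (N : ℝ) ≤ (2 : ℝ) ^ N := by exact_mod_cast Nat.lt_two_pow_self.le
      _ = (2 : ℝ) ^ (N : ℤ) := (zpow_natCast _ _).symm
      _ ≤ 2 ^ (-j) := zpow_le_zpow_right₀ one_le_two (by omega)
  have h3 : (1 : ℝ) ≤ 2 ^ (-j) := one_le_zpow₀ one_le_two (by omega)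
  exact h2.trans (le_self_pow₀ h3 hd.ne')

/-- The family consists of the maximal cubes with average above `τ`. Nestedness makes them disjoint,
the parent of each has average at most `τ`, and a point in none of them lies only in cubes with
average at most `τ`, so differentiation applies. -/
theorem exists_isStoppingFamily {d : ℕ} (hd : 0 < d) {F : Type*} [NormedAddCommGroup F]
    {f : EuclideanSpace ℝ (Fin d) → F} (hf : Integrable f volume) (u : Fin d → Fin 3) {τ : ℝ≥0∞}
    (hτ : τ ≠ 0) (hτ' : τ ≠ ∞) : ∃ P, IsStoppingFamily f u τ P := by
  set bad : ℤ → (Fin d → ℤ) → Prop := fun j m =>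
    τ * volume (dyadicCube u j m) < ∫⁻ y in dyadicCube u j m, ‖f y‖ₑ with hbad
  obtain ⟨b, hb⟩ := exists_gen_lower_bound hd hf.2.ne hτ hτ'
  have hb' : ∀ j m, bad j m → b ≤ j := fun j m h =>
    hb u j m (h.trans_le (setLIntegral_le_lintegral _ _))
  have hmax : ∀ j m, bad j m → ∃ i ∈ {i : ℤ × (Fin d → ℤ) | bad i.1 i.2 ∧ ∀ j' m', j' < i.1 →
      dyadicCube u i.1 i.2 ⊆ dyadicCube u j' m' → ¬ bad j' m'},
      dyadicCube u j m ⊆ dyadicCube u i.1 i.2 := by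
    intro j m h
    obtain ⟨j0, ⟨m0, h0, h0'⟩, hmin⟩ := Int.exists_least_of_bdd
      (P := fun j' => ∃ m', bad j' m' ∧ dyadicCube u j m ⊆ dyadicCube u j' m')
      ⟨b, fun z ⟨m', hz, _⟩ => hb' z m' hz⟩ ⟨j, m, h, Subset.rfl⟩
    exact ⟨(j0, m0), ⟨h0, fun j' m' hj' hsub hb2 =>
      (hmin j' ⟨m', hb2, h0'.trans hsub⟩).not_gt hj'⟩, h0'⟩
  refine ⟨_, ?_, fun i hi => hi.1, fun i hi => ?_, hmax, ?_⟩
  · have aux : ∀ i i' : ℤ × (Fin d → ℤ), bad i.1 i.2 → (∀ j' m', j' < i'.1 →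
        dyadicCube u i'.1 i'.2 ⊆ dyadicCube u j' m' → ¬ bad j' m') → i.1 ≤ i'.1 → ∀ x,
        x ∈ dyadicCube u i.1 i.2 → x ∈ dyadicCube u i'.1 i'.2 → i = i' := by
      rintro ⟨j, m⟩ ⟨j', m'⟩ h1 h2 hle x hx hx'
      rcases hle.lt_or_eq with hlt | heq
      · exact absurd h1 (h2 _ _ hlt (dyadicCube_subset_of_le hx' hx hle))
      · simp only at heq
        subst heq
        have hm : m = m' := dyadicCube_index_unique hx hx'
        rw [hm]
    intro i hi i' hi' hne
    refine disjoint_left.2 fun x hx hx' => hne ?_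
    rcases le_total i.1 i'.1 with h | h
    · exact aux i i' hi.1 hi'.2 h x hx hx'
    · exact (aux i' i hi'.1 hi.2 h x hx' hx).symm
  -- The parent violates the stopping condition by maximality; its measure is `2^d` times larger.
  · obtain ⟨n, hn⟩ := dyadicCube_subset_parent u i.1 i.2
    have h1 := not_lt.1 (hi.2 _ _ (by omega) hn)
    refine (lintegral_mono_set hn).trans (h1.trans_eq ?_)
    have := volume_dyadicCube_sub u u i.1 1 i.2 n
    rw [Nat.cast_one] at this
    rw [this, pow_one]
    ring
  · filter_upwards [ae_enorm_le_of_forall_dyadicCube hd hf u] with x hx hx'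
    refine hx τ fun j m hm => ?_
    by_contra! h
    obtain ⟨i, hi, hsub⟩ := hmax j m h
    exact hx' i hi (hsub hm)

theorem IsStoppingFamily.tsum_setLIntegral_le {d : ℕ} {F : Type*} [NormedAddCommGroup F]
    {f : EuclideanSpace ℝ (Fin d) → F} {u : Fin d → Fin 3} {τ : ℝ≥0∞}
    {P : Set (ℤ × (Fin d → ℤ))} (h : IsStoppingFamily f u τ P) :
    ∑' i : P, ∫⁻ y in dyadicCube u i.1.1 i.1.2, ‖f y‖ₑ ≤ ∫⁻ y, ‖f y‖ₑ := by
  rw [← lintegral_biUnion (to_countable P) (fun i _ => measurableSet_dyadicCube u i.1 i.2)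
    h.disjoint]
  exact setLIntegral_le_lintegral _ _

theorem IsStoppingFamily.sum_setLIntegral_le {d : ℕ} {F : Type*} [NormedAddCommGroup F]
    {f : EuclideanSpace ℝ (Fin d) → F} {u : Fin d → Fin 3} {τ : ℝ≥0∞}
    {P : Set (ℤ × (Fin d → ℤ))} (h : IsStoppingFamily f u τ P) (s : Finset P) :
    ∑ i ∈ s, ∫⁻ y in dyadicCube u i.1.1 i.1.2, ‖f y‖ₑ ≤ ∫⁻ y, ‖f y‖ₑ :=
  (ENNReal.sum_le_tsum s).trans h.tsum_setLIntegral_le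

theorem IsStoppingFamily.tsum_le {d : ℕ} {F : Type*} [NormedAddCommGroup F]
    {f : EuclideanSpace ℝ (Fin d) → F} {u : Fin d → Fin 3} {τ : ℝ≥0∞}
    {P : Set (ℤ × (Fin d → ℤ))} (h : IsStoppingFamily f u τ P) :
    τ * ∑' i : P, volume (dyadicCube u i.1.1 i.1.2) ≤ ∫⁻ y, ‖f y‖ₑ := by
  rw [← ENNReal.tsum_mul_left]
  refine le_trans (ENNReal.tsum_le_tsum fun i => ?_) h.tsum_setLIntegral_le
  exact (h.lt i i.2).le

/-- The weak type estimate for the dyadic maximal function. -/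
theorem volume_dyadicMaximal_le {d : ℕ} (hd : 0 < d) {F : Type*} [NormedAddCommGroup F]
    {f : EuclideanSpace ℝ (Fin d) → F} (hf : Integrable f volume) (u : Fin d → Fin 3) {τ : ℝ≥0∞}
    (hτ : τ ≠ 0) (hτ' : τ ≠ ∞) :
    ∃ U : Set (EuclideanSpace ℝ (Fin d)), MeasurableSet U ∧ τ * volume U ≤ ∫⁻ y, ‖f y‖ₑ ∧
      ∀ j m, τ * volume (dyadicCube u j m) < ∫⁻ y in dyadicCube u j m, ‖f y‖ₑ →
        dyadicCube u j m ⊆ U := by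
  obtain ⟨P, hP⟩ := exists_isStoppingFamily hd hf u hτ hτ'
  refine ⟨⋃ i ∈ P, dyadicCube u i.1 i.2, MeasurableSet.biUnion (to_countable P) fun i _ =>
    measurableSet_dyadicCube u i.1 i.2, ?_, fun j m h => ?_⟩
  · refine le_trans ?_ hP.tsum_le
    gcongr
    exact measure_biUnion_le _ (to_countable P) _
  · obtain ⟨i, hi, hsub⟩ := hP.maximal j m h
    exact hsub.trans (subset_biUnion_of_mem (u := fun i : ℤ × (Fin d → ℤ) =>
      dyadicCube u i.1 i.2) hi)

/-! ### Tail integrals -/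

theorem exists_dyadic_annulus {s ρ : ℝ} (hs : 0 < s) (h : s ≤ ρ) :
    ∃ k : ℕ, 2 ^ k * s ≤ ρ ∧ ρ ≤ 2 ^ (k + 1) * s := by
  obtain ⟨k, h1, h2⟩ := exists_nat_pow_near ((one_le_div hs).2 h) one_lt_two
  exact ⟨k, (le_div_iff₀ hs).1 h1, ((div_lt_iff₀ hs).1 h2).le⟩

/-- Split the complement into annuli `2^k s ≤ |y - c| ≤ 2^(k+1) s`. The weight on the `k`-th is at
most `2^{-αk} (2^k s)^{-d}`, while the mass is at most `M (2^(k+1) s)^d`, so a geometric series with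
ratio `2^{-α}` and the factor `2^d` remain. -/
theorem lintegral_tail_le {d : ℕ} {α : ℝ} (hα : 0 < α) (c : EuclideanSpace ℝ (Fin d)) {s : ℝ}
    (hs : 0 < s) {g : EuclideanSpace ℝ (Fin d) → ℝ≥0∞} (hg : AEMeasurable g volume) {M : ℝ≥0∞}
    (hM : ∀ ρ, s ≤ ρ → ∫⁻ y in closedBall c ρ, g y ≤ M * ENNReal.ofReal (ρ ^ d)) :
    ∫⁻ y in (closedBall c s)ᶜ,
        ENNReal.ofReal ((s / ‖y - c‖) ^ α * (1 / ‖y - c‖ ^ d)) * g y ≤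
      ENNReal.ofReal (2 ^ d * (1 - 2 ^ (-α))⁻¹) * M := by
  have hq0 : (0 : ℝ) ≤ 2 ^ (-α) := by positivity
  have hq1 : (2 : ℝ) ^ (-α) < 1 := Real.rpow_lt_one_of_one_lt_of_neg one_lt_two (by linarith)
  set q : ℝ := 2 ^ (-α) with hq
  set w : ℕ → ℝ := fun k => q ^ k * (1 / (2 ^ k * s) ^ d) with hw
  have hw0 : ∀ k, 0 ≤ w k := fun k => by positivity
  have hpt : ∀ y ∈ (closedBall c s)ᶜ,
      ENNReal.ofReal ((s / ‖y - c‖) ^ α * (1 / ‖y - c‖ ^ d)) * g y ≤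
        ∑' k : ℕ, ENNReal.ofReal (w k) * (closedBall c (2 ^ (k + 1) * s)).indicator g y := by
    intro y hy
    rw [mem_compl_iff, mem_closedBall, not_le, dist_eq_norm] at hy
    obtain ⟨k, hk1, hk2⟩ := exists_dyadic_annulus hs hy.le
    refine le_trans ?_ (ENNReal.le_tsum k)
    rw [indicator_of_mem (by rwa [mem_closedBall, dist_eq_norm])]
    gcongr
    have hpos : 0 < 2 ^ k * s := by positivity
    have : s / ‖y - c‖ ≤ (1 / 2) ^ k := by
      rw [div_le_iff₀ (hs.trans hy), one_div, inv_pow, ← div_eq_inv_mul, le_div_iff₀ (by positivity),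
        mul_comm]
      exact hk1
    have h1 : (s / ‖y - c‖) ^ α ≤ q ^ k := by
      calc (s / ‖y - c‖) ^ α ≤ ((1 / 2) ^ k) ^ α :=
            Real.rpow_le_rpow (by positivity) this hα.le
        _ = q ^ k := by
            rw [hq, Real.rpow_neg zero_le_two, ← Real.inv_rpow zero_le_two, ← one_div,
              ← Real.rpow_natCast, ← Real.rpow_natCast, ← Real.rpow_mul (by positivity),
              ← Real.rpow_mul (by positivity), mul_comm]
    simp only [hw]
    gcongr
  calc ∫⁻ y in (closedBall c s)ᶜ, ENNReal.ofReal ((s / ‖y - c‖) ^ α * (1 / ‖y - c‖ ^ d)) * g y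
      ≤ ∫⁻ y in (closedBall c s)ᶜ,
          ∑' k : ℕ, ENNReal.ofReal (w k) * (closedBall c (2 ^ (k + 1) * s)).indicator g y :=
        setLIntegral_mono' measurableSet_closedBall.compl hpt
    _ ≤ ∫⁻ y, ∑' k : ℕ, ENNReal.ofReal (w k) * (closedBall c (2 ^ (k + 1) * s)).indicator g y :=
        setLIntegral_le_lintegral _ _
    _ = ∑' k : ℕ, ENNReal.ofReal (w k) * ∫⁻ y in closedBall c (2 ^ (k + 1) * s), g y := by
        rw [lintegral_tsum fun k => (hg.indicator measurableSet_closedBall).const_mul _]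
        refine tsum_congr fun k => ?_
        rw [lintegral_const_mul' _ _ ENNReal.ofReal_ne_top,
          lintegral_indicator measurableSet_closedBall]
    _ ≤ ∑' k : ℕ, ENNReal.ofReal (2 ^ d * q ^ k) * M := by
        refine ENNReal.tsum_le_tsum fun k => ?_
        have hsk : s ≤ 2 ^ (k + 1) * s := le_mul_of_one_le_left hs.le (one_le_pow₀ one_le_two)
        refine (mul_le_mul_right (hM _ hsk) _).trans_eq ?_
        rw [mul_comm M, ← mul_assoc, ← ENNReal.ofReal_mul (hw0 k)]
        congr 2
        simp only [hw]
        rw [pow_succ, mul_assoc (2 ^ k), mul_left_comm (2 ^ k), mul_pow 2]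
        field_simp
    _ = ENNReal.ofReal (2 ^ d * (1 - q)⁻¹) * M := by
        rw [ENNReal.tsum_mul_right, ← tsum_geometric_of_lt_one hq0 hq1, ← tsum_mul_left,
          ENNReal.ofReal_tsum_of_nonneg (fun k => by positivity)
            ((summable_geometric_of_lt_one hq0 hq1).mul_left _)]

/-! ### Bounded functions with compact support -/

theorem IsBddCompactlySupported.integrable {d : ℕ} {E : Type*} [NormedAddCommGroup E]
    {f : EuclideanSpace ℝ (Fin d) → E} (hf : IsBddCompactlySupported f) : Integrable f volume :=
  memLp_one_iff_integrable.1 (hf.memLp 1)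

theorem IsBddCompactlySupported.indicator {d : ℕ} {E : Type*} [NormedAddCommGroup E]
    {f : EuclideanSpace ℝ (Fin d) → E} (hf : IsBddCompactlySupported f)
    {s : Set (EuclideanSpace ℝ (Fin d))} (hs : MeasurableSet s) :
    IsBddCompactlySupported (s.indicator f) := by
  obtain ⟨M, hM⟩ := hf.bounded
  refine ⟨hf.aestronglyMeasurable.indicator hs, ⟨M,
    fun x => (norm_indicator_le_norm_self _ _).trans (hM x)⟩, ?_⟩
  exact hf.hasCompactSupport.mono fun x hx h => hx (by simp [Set.indicator, h])

theorem IsBddCompactlySupported.sub {d : ℕ} {E : Type*} [NormedAddCommGroup E]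
    {f g : EuclideanSpace ℝ (Fin d) → E} (hf : IsBddCompactlySupported f)
    (hg : IsBddCompactlySupported g) : IsBddCompactlySupported (f - g) := by
  obtain ⟨M, hM⟩ := hf.bounded
  obtain ⟨N, hN⟩ := hg.bounded
  refine ⟨hf.aestronglyMeasurable.sub hg.aestronglyMeasurable, ⟨M + N,
    fun x => (norm_sub_le _ _).trans (add_le_add (hM x) (hN x))⟩, ?_⟩
  exact hf.hasCompactSupport.sub hg.hasCompactSupport

theorem IsBddCompactlySupported.indicator_const {d : ℕ} {E : Type*} [NormedAddCommGroup E]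
    {s : Set (EuclideanSpace ℝ (Fin d))} (hs : MeasurableSet s) (hb : Bornology.IsBounded s)
    (e : E) : IsBddCompactlySupported (s.indicator fun _ => e) := by
  refine ⟨aestronglyMeasurable_const.indicator hs, ⟨‖e‖,
    fun x => norm_indicator_le_norm_self (fun _ => e) x⟩, ?_⟩
  exact HasCompactSupport.of_support_subset_isCompact hb.isCompact_closure
    (support_indicator_subset.trans subset_closure)

/-! ### Singular kernels -/

theorem IsSingularKernel.mono {d : ℕ} {E : Type*} [NormedAddCommGroup E] [NormedSpace ℝ E]
    {α B B' : ℝ} {K : EuclideanSpace ℝ (Fin d) → EuclideanSpace ℝ (Fin d) → (E →L[ℝ] E)}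
    (hK : IsSingularKernel α B K) (h : B ≤ B') : IsSingularKernel α B' K := by
  refine ⟨fun x y hxy => (hK.decay x y hxy).trans ?_,
    fun x x' y h1 h2 => (hK.holder_left x x' y h1 h2).trans ?_,
    fun x y y' h1 h2 => (hK.holder_right x y y' h1 h2).trans ?_⟩ <;> gcongr

theorem IsCalderonZygmund.mono {d : ℕ} {E : Type*} [NormedAddCommGroup E] [NormedSpace ℝ E]
    {p : ℝ≥0∞} [Fact (1 ≤ p)] {α A B A' B' : ℝ}
    {T : Lp E p (volume : Measure (EuclideanSpace ℝ (Fin d))) →L[ℝ]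
      Lp E p (volume : Measure (EuclideanSpace ℝ (Fin d)))} (hT : IsCalderonZygmund α A B T)
    (hA : A ≤ A') (hB : B ≤ B') : IsCalderonZygmund α A' B' T := by
  obtain ⟨K, hK, h⟩ := hT.exists_kernel
  exact ⟨hT.norm_le.trans hA, K, hK.mono hB, h⟩

/-- Measurability of the kernel is not part of the definition. Hölder regularity supplies it off the
diagonal, through continuity in the second variable. -/
theorem IsSingularKernel.continuousOn_right {d : ℕ} {E : Type*} [NormedAddCommGroup E]
    [NormedSpace ℝ E] {α B : ℝ} (hα : 0 < α)
    {K : EuclideanSpace ℝ (Fin d) → EuclideanSpace ℝ (Fin d) → (E →L[ℝ] E)}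
    (hK : IsSingularKernel α B K) (x : EuclideanSpace ℝ (Fin d)) :
    ContinuousOn (K x) {x}ᶜ := by
  refine fun y hy => ContinuousAt.continuousWithinAt ?_
  have hxy : 0 < ‖x - y‖ := norm_pos_iff.2 (sub_ne_zero.2 fun h => hy h.symm)
  rw [ContinuousAt, tendsto_iff_norm_sub_tendsto_zero]
  have hlim : Tendsto (fun y' => B * ((‖y - y'‖ / ‖x - y‖) ^ α * (1 / ‖x - y‖ ^ d))) (𝓝 y)
      (𝓝 0) := by
    have h : Continuous fun y' => B * ((‖y - y'‖ / ‖x - y‖) ^ α * (1 / ‖x - y‖ ^ d)) :=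
      continuous_const.mul (((continuous_const.sub continuous_id).norm.div_const _).rpow_const
        (fun _ => Or.inr hα.le) |>.mul continuous_const)
    have h' := h.tendsto y
    simpa [Real.zero_rpow hα.ne'] using h'
  refine squeeze_zero' (Eventually.of_forall fun _ => norm_nonneg _) ?_ hlim
  filter_upwards [ball_mem_nhds y (show 0 < 1 / 2 * ‖x - y‖ by positivity)] with y' hy'
  rw [mem_ball, dist_comm, dist_eq_norm] at hy'
  rcases eq_or_ne y y' with rfl | hne
  · simp [Real.zero_rpow hα.ne']
  · rw [norm_sub_rev]
    exact hK.holder_right x y y' (norm_pos_iff.2 (sub_ne_zero.2 hne)) hy'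

theorem IsSingularKernel.integrable {d : ℕ} {E : Type*} [NormedAddCommGroup E]
    [NormedSpace ℝ E] {α B : ℝ} (hα : 0 < α) (hB : 0 ≤ B)
    {K : EuclideanSpace ℝ (Fin d) → EuclideanSpace ℝ (Fin d) → (E →L[ℝ] E)}
    (hK : IsSingularKernel α B K) {x : EuclideanSpace ℝ (Fin d)} {s : ℝ} (hs : 0 < s)
    {h : EuclideanSpace ℝ (Fin d) → E} (hh : IsBddCompactlySupported h)
    (h0 : ∀ y ∈ closedBall x s, h y = 0) : Integrable (fun y => K x y (h y)) volume := by
  have hsupp : Function.support (fun y => K x y (h y)) ⊆ (closedBall x s)ᶜ := by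
    intro y hy hyx
    exact hy (by simp only [h0 y hyx, map_zero])
  rw [← integrableOn_iff_integrable_of_support_subset hsupp]
  have hsub : (closedBall x s)ᶜ ⊆ ({x}ᶜ : Set (EuclideanSpace ℝ (Fin d))) :=
    compl_subset_compl.2 (singleton_subset_iff.2 (mem_closedBall_self hs.le))
  refine Integrable.mono' (g := fun y => B * (1 / s ^ d) * ‖h y‖)
    (hh.integrable.norm.const_mul _).integrableOn ?_ ?_
  · exact (ContinuousLinearMap.id ℝ (E →L[ℝ] E)).aestronglyMeasurable_comp₂
      (((hK.continuousOn_right hα x).mono hsub).aestronglyMeasurable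
        measurableSet_closedBall.compl) hh.aestronglyMeasurable.restrict
  · refine (ae_restrict_iff' measurableSet_closedBall.compl).2 (Eventually.of_forall fun y hy => ?_)
    rw [mem_compl_iff, mem_closedBall, not_le, dist_comm, dist_eq_norm] at hy
    refine (ContinuousLinearMap.le_opNorm _ _).trans ?_
    gcongr
    refine (hK.decay x y fun hxy => ?_).trans ?_
    · simp [hxy] at hy
      linarith
    · gcongr

/-- The decay of the difference of two values of a singular kernel, as a function of the distance
to a centre `c` at scale `s`. -/
noncomputable def kernelWeight {d : ℕ} (α : ℝ) (c : EuclideanSpace ℝ (Fin d)) (s : ℝ)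
    (y : EuclideanSpace ℝ (Fin d)) : ℝ≥0∞ :=
  ENNReal.ofReal ((s / ‖y - c‖) ^ α * (1 / ‖y - c‖ ^ d))

/-- The radius `s / 4` ensures `|c - x| < |c - y| / 2`, as the Hölder condition requires. Replacing
`|c - x|` by `s` makes the bound independent of `x`. -/
theorem IsSingularKernel.enorm_sub_le_left {d : ℕ} {E : Type*} [NormedAddCommGroup E]
    [NormedSpace ℝ E] {α B : ℝ} (hα : 0 < α) (hB : 0 ≤ B)
    {K : EuclideanSpace ℝ (Fin d) → EuclideanSpace ℝ (Fin d) → (E →L[ℝ] E)}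
    (hK : IsSingularKernel α B K) {c x y : EuclideanSpace ℝ (Fin d)} {s : ℝ} (hs : 0 < s)
    (hx : x ∈ closedBall c (s / 4)) (hy : y ∉ closedBall c s) :
    ‖K x y - K c y‖ₑ ≤ ENNReal.ofReal B * kernelWeight α c s y := by
  rw [mem_closedBall, dist_comm, dist_eq_norm] at hx
  rw [mem_closedBall, not_le, dist_comm, dist_eq_norm] at hy
  rw [kernelWeight, ← ENNReal.ofReal_mul hB, ← ofReal_norm]
  refine ENNReal.ofReal_le_ofReal ?_
  rcases eq_or_ne c x with rfl | hne
  · rw [sub_self, norm_zero]; positivity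
  · rw [norm_sub_rev, norm_sub_rev y c]
    refine (hK.holder_left c x y (norm_pos_iff.2 (sub_ne_zero.2 hne)) (by linarith)).trans ?_
    have : ‖c - x‖ ≤ s := by linarith
    gcongr

theorem IsSingularKernel.enorm_sub_le_right {d : ℕ} {E : Type*} [NormedAddCommGroup E]
    [NormedSpace ℝ E] {α B : ℝ} (hα : 0 < α) (hB : 0 ≤ B)
    {K : EuclideanSpace ℝ (Fin d) → EuclideanSpace ℝ (Fin d) → (E →L[ℝ] E)}
    (hK : IsSingularKernel α B K) {c x y : EuclideanSpace ℝ (Fin d)} {s : ℝ} (hs : 0 < s)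
    (hy : y ∈ closedBall c (s / 4)) (hx : x ∉ closedBall c s) :
    ‖K x y - K x c‖ₑ ≤ ENNReal.ofReal B * kernelWeight α c s x := by
  rw [mem_closedBall, dist_comm, dist_eq_norm] at hy
  rw [mem_closedBall, not_le, dist_eq_norm] at hx
  rw [kernelWeight, ← ENNReal.ofReal_mul hB, ← ofReal_norm]
  refine ENNReal.ofReal_le_ofReal ?_
  rcases eq_or_ne c y with rfl | hne
  · rw [sub_self, norm_zero]; positivity
  · rw [norm_sub_rev]
    refine (hK.holder_right x c y (norm_pos_iff.2 (sub_ne_zero.2 hne)) (by linarith)).trans ?_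
    have : ‖c - y‖ ≤ s := by linarith
    gcongr

/-! ### Estimates for the operator away from the support, and in the mean. -/

section Operator

variable {d : ℕ} {E : Type*} [NormedAddCommGroup E] [NormedSpace ℝ E]
  {p : ℝ≥0∞} [Fact (1 ≤ p)] {α A B : ℝ}
  {T : Lp E p (volume : Measure (EuclideanSpace ℝ (Fin d))) →L[ℝ]
    Lp E p (volume : Measure (EuclideanSpace ℝ (Fin d)))}

/-- If `h` vanishes on a ball, then `T h` is nearly constant on the concentric ball of a quarter of
the radius. -/
theorem IsCalderonZygmund.exists_ae_enorm_sub_le (hα : 0 < α) (hB : 0 ≤ B)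
    (hT : IsCalderonZygmund α A B T) {c : EuclideanSpace ℝ (Fin d)} {s : ℝ} (hs : 0 < s)
    {h : EuclideanSpace ℝ (Fin d) → E} (hh : IsBddCompactlySupported h)
    (h0 : ∀ y ∈ closedBall c s, h y = 0) :
    ∃ e : E, ∀ᵐ x, x ∈ closedBall c (s / 4) → ‖T ((hh.memLp p).toLp h) x - e‖ₑ ≤
      ENNReal.ofReal B * ∫⁻ y in (closedBall c s)ᶜ, kernelWeight α c s y * ‖h y‖ₑ := by
  obtain ⟨K, hK, hrep⟩ := hT.exists_kernel
  -- The constant is the kernel integral at the centre, which converges since `h` vanishes near `c`.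
  -- It need not be a value of the class `T h`.
  refine ⟨∫ y, K c y (h y), ?_⟩
  filter_upwards [hrep h hh] with x hx hxc
  have hxs : x ∉ tsupport h := by
    rw [notMem_tsupport_iff_eventuallyEq]
    filter_upwards [closedBall_mem_nhds_of_mem
      (show x ∈ ball c s from lt_of_le_of_lt (mem_closedBall.1 hxc) (by linarith))] with y hy using h0 y hy
  have hball : closedBall x (s / 4) ⊆ closedBall c s := by
    refine closedBall_subset_closedBall' ?_
    have := mem_closedBall.1 hxc
    linarith
  rw [hx hxs, ← integral_sub
    (hK.integrable hα hB (by positivity : 0 < s / 4) hh fun y hy => h0 y (hball hy))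
    (hK.integrable hα hB hs hh h0)]
  refine (enorm_integral_le_lintegral_enorm _).trans ?_
  rw [← lintegral_const_mul' _ _ ENNReal.ofReal_ne_top,
    ← lintegral_indicator measurableSet_closedBall.compl]
  refine lintegral_mono fun y => ?_
  by_cases hy : y ∈ closedBall c s
  · simp [h0 y hy]
  · rw [indicator_of_mem (by exact hy), ← sub_apply, ← mul_assoc]
    refine (ContinuousLinearMap.le_opENorm _ _).trans ?_
    gcongr
    exact hK.enorm_sub_le_left hα hB hs hxc hy

/-- Since `b` has mean zero, `K x c` may be subtracted from the kernel, and the regularity in the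
second variable yields decay in `x` that is integrable at infinity. -/
theorem IsCalderonZygmund.ae_enorm_le_of_integral_eq_zero [CompleteSpace E] (hα : 0 < α)
    (hB : 0 ≤ B)
    (hT : IsCalderonZygmund α A B T) {c : EuclideanSpace ℝ (Fin d)} {s : ℝ} (hs : 0 < s)
    {b : EuclideanSpace ℝ (Fin d) → E} (hb : IsBddCompactlySupported b)
    (h0 : ∀ y, y ∉ closedBall c (s / 4) → b y = 0) (hint : ∫ y, b y = 0) :
    ∀ᵐ x, x ∉ closedBall c s → ‖T ((hb.memLp p).toLp b) x‖ₑ ≤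
      ENNReal.ofReal B * (kernelWeight α c s x * ∫⁻ y, ‖b y‖ₑ) := by
  obtain ⟨K, hK, hrep⟩ := hT.exists_kernel
  filter_upwards [hrep b hb] with x hx hxc
  have hsupp : tsupport b ⊆ closedBall c (s / 4) :=
    closure_minimal (fun y hy => by_contra fun h => hy (h0 y h)) isClosed_closedBall
  have hxs : x ∉ tsupport b := fun h =>
    hxc (closedBall_subset_closedBall (by linarith) (hsupp h))
  have hball : ∀ y ∈ closedBall x (s / 2), b y = 0 := by
    refine fun y hy => h0 y fun hyc => hxc ?_
    rw [mem_closedBall] at *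
    linarith [dist_triangle x y c, dist_comm x y]
  have hi : Integrable (fun y => K x c (b y)) volume := (K x c).integrable_comp hb.integrable
  have hz : ∫ y, K x c (b y) = 0 := by
    rw [(K x c).integral_comp_comm hb.integrable, hint, map_zero]
  rw [hx hxs, ← sub_zero (∫ y, K x y (b y)), ← hz, ← integral_sub
    (hK.integrable hα hB (by positivity : 0 < s / 2) hb hball) hi]
  refine (enorm_integral_le_lintegral_enorm _).trans ?_
  rw [← lintegral_const_mul' _ _ (by rw [kernelWeight]; exact ENNReal.ofReal_ne_top),
    ← lintegral_const_mul' _ _ ENNReal.ofReal_ne_top]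
  refine lintegral_mono fun y => ?_
  by_cases hy : y ∈ closedBall c (s / 4)
  · rw [← sub_apply, ← mul_assoc]
    refine (ContinuousLinearMap.le_opENorm _ _).trans ?_
    gcongr
    exact hK.enorm_sub_le_right hα hB hs hy hxc
  · simp [h0 y hy]

/-- The pointwise decay is integrated by the tail bound with `g = 1`, for which `M` is the measure
of the unit ball. It is the estimate of a single bad part in the Calderón–Zygmund decomposition. -/
theorem IsCalderonZygmund.setLIntegral_enorm_le [CompleteSpace E] (hα : 0 < α) (hB : 0 ≤ B)
    (hT : IsCalderonZygmund α A B T) {c : EuclideanSpace ℝ (Fin d)} {s : ℝ} (hs : 0 < s)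
    {b : EuclideanSpace ℝ (Fin d) → E} (hb : IsBddCompactlySupported b)
    (h0 : ∀ y, y ∉ closedBall c (s / 4) → b y = 0) (hint : ∫ y, b y = 0) :
    ∫⁻ x in (closedBall c s)ᶜ, ‖T ((hb.memLp p).toLp b) x‖ₑ ≤
      ENNReal.ofReal B * (ENNReal.ofReal (2 ^ d * (1 - 2 ^ (-α))⁻¹) *
        volume (ball (0 : EuclideanSpace ℝ (Fin d)) 1)) * ∫⁻ y, ‖b y‖ₑ := by
  have htail := lintegral_tail_le (d := d) hα c hs (g := fun _ => 1) aemeasurable_const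
    (M := volume (ball (0 : EuclideanSpace ℝ (Fin d)) 1)) (fun ρ hρ => by
      rw [setLIntegral_one, Measure.addHaar_closedBall _ _ (hs.le.trans hρ),
        finrank_euclideanSpace_fin, mul_comm])
  have hb' : ∫⁻ y, ‖b y‖ₑ ≠ ∞ := hb.integrable.2.ne
  calc ∫⁻ x in (closedBall c s)ᶜ, ‖T ((hb.memLp p).toLp b) x‖ₑ
      ≤ ∫⁻ x in (closedBall c s)ᶜ,
          ENNReal.ofReal B * (kernelWeight α c s x * ∫⁻ y, ‖b y‖ₑ) := by
        refine lintegral_mono_ae ((ae_restrict_iff' measurableSet_closedBall.compl).2 ?_)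
        exact hT.ae_enorm_le_of_integral_eq_zero hα hB hs hb h0 hint
    _ = ENNReal.ofReal B * (∫⁻ x in (closedBall c s)ᶜ, kernelWeight α c s x * 1) *
          ∫⁻ y, ‖b y‖ₑ := by
        rw [lintegral_const_mul' _ _ ENNReal.ofReal_ne_top, lintegral_mul_const' _ _ hb',
          mul_assoc]
        simp only [mul_one]
    _ ≤ _ := by
        gcongr
        exact htail

/-- The Chebyshev inequality for `T`. -/
theorem IsCalderonZygmund.rpow_mul_volume_le (hp : p ≠ ∞) (hA : 0 < A)
    (hT : IsCalderonZygmund α A B T)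
    (G : Lp E p (volume : Measure (EuclideanSpace ℝ (Fin d)))) {τ : ℝ≥0∞} :
    τ ^ p.toReal * volume {x | ENNReal.ofReal A * τ ≤ ‖T G x‖ₑ} ≤
      ∫⁻ x, ‖G x‖ₑ ^ p.toReal := by
  have hp1 : (1 : ℝ≥0∞) ≤ p := Fact.out
  have hp0 : p ≠ 0 := (zero_lt_one.trans_le hp1).ne'
  have hpr : 0 < p.toReal := ENNReal.toReal_pos hp0 hp
  have hpow : ∀ H : Lp E p (volume : Measure (EuclideanSpace ℝ (Fin d))),
      ‖H‖ₑ ^ p.toReal = ∫⁻ x, ‖H x‖ₑ ^ p.toReal := fun H => by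
    rw [Lp.enorm_def, eLpNorm_eq_lintegral_rpow_enorm_toReal hp0 hp, ← ENNReal.rpow_mul,
      one_div_mul_cancel hpr.ne', ENNReal.rpow_one]
  have hA0 : ENNReal.ofReal A ^ p.toReal ≠ 0 :=
    (ENNReal.rpow_pos (ENNReal.ofReal_pos.2 hA) ENNReal.ofReal_ne_top).ne'
  have hA1 : ENNReal.ofReal A ^ p.toReal ≠ ∞ :=
    ENNReal.rpow_ne_top_of_nonneg hpr.le ENNReal.ofReal_ne_top
  rw [← ENNReal.mul_le_mul_iff_right hA0 hA1]
  calc ENNReal.ofReal A ^ p.toReal * (τ ^ p.toReal *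
        volume {x | ENNReal.ofReal A * τ ≤ ‖T G x‖ₑ})
      = (ENNReal.ofReal A * τ) ^ p.toReal *
          volume {x | (ENNReal.ofReal A * τ) ^ p.toReal ≤ ‖T G x‖ₑ ^ p.toReal} := by
        rw [← mul_assoc, ← ENNReal.mul_rpow_of_nonneg _ _ hpr.le]
        simp only [ENNReal.rpow_le_rpow_iff hpr]
    _ ≤ ∫⁻ x, ‖T G x‖ₑ ^ p.toReal :=
        mul_meas_ge_le_lintegral₀ ((Lp.aestronglyMeasurable _).enorm.pow_const _) _
    _ = ‖T G‖ₑ ^ p.toReal := (hpow _).symm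
    _ ≤ (ENNReal.ofReal A * ‖G‖ₑ) ^ p.toReal := by
        refine ENNReal.rpow_le_rpow ((T.le_opENorm G).trans ?_) hpr.le
        gcongr
        rw [← ofReal_norm]
        exact ENNReal.ofReal_le_ofReal hT.norm_le
    _ = ENNReal.ofReal A ^ p.toReal * ∫⁻ x, ‖G x‖ₑ ^ p.toReal := by
        rw [ENNReal.mul_rpow_of_nonneg _ _ hpr.le, hpow]

end Operator

/-! ### The weak type estimate -/

theorem isBounded_dyadicCube {d : ℕ} (u : Fin d → Fin 3) (j : ℤ) (m : Fin d → ℤ) :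
    Bornology.IsBounded (dyadicCube u j m) :=
  isBounded_closedBall.subset (dyadicCube_subset_closedBall (dyadicCorner_mem u j m))

theorem volume_closedBall_dyadicCorner {d : ℕ} (u : Fin d → Fin 3) (j : ℤ) (m : Fin d → ℤ) :
    volume (closedBall (dyadicCorner u j m) (4 * dyadicRadius d j)) =
      ENNReal.ofReal ((4 * d) ^ d) * volume (ball (0 : EuclideanSpace ℝ (Fin d)) 1) *
        volume (dyadicCube u j m) := by
  rw [Measure.addHaar_closedBall _ _ (by unfold dyadicRadius; positivity), volume_dyadicCube,
    finrank_euclideanSpace_fin, dyadicRadius, ← mul_assoc, mul_pow,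
    ENNReal.ofReal_mul (by positivity)]
  ring

/-- The part of `f` on a set `Q`, with its mean subtracted. -/
noncomputable def meanZeroPart {d : ℕ} {E : Type*} [NormedAddCommGroup E] [NormedSpace ℝ E]
    (f : EuclideanSpace ℝ (Fin d) → E) (Q : Set (EuclideanSpace ℝ (Fin d))) :
    EuclideanSpace ℝ (Fin d) → E :=
  Q.indicator fun y => f y - ⨍ z in Q, f z

section MeanZero

variable {d : ℕ} {E : Type*} [NormedAddCommGroup E] [NormedSpace ℝ E]
  {f : EuclideanSpace ℝ (Fin d) → E}

theorem IsBddCompactlySupported.meanZeroPart (hf : IsBddCompactlySupported f)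
    (u : Fin d → Fin 3) (j : ℤ) (m : Fin d → ℤ) :
    IsBddCompactlySupported (meanZeroPart f (dyadicCube u j m)) := by
  have h := (hf.indicator (measurableSet_dyadicCube u j m)).sub
    (IsBddCompactlySupported.indicator_const (measurableSet_dyadicCube u j m)
      (isBounded_dyadicCube u j m) (⨍ z in dyadicCube u j m, f z))
  rwa [← indicator_sub'] at h

theorem integral_meanZeroPart [CompleteSpace E] (f : EuclideanSpace ℝ (Fin d) → E)
    (u : Fin d → Fin 3) (j : ℤ) (m : Fin d → ℤ) :
    ∫ y, meanZeroPart f (dyadicCube u j m) y = 0 := by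
  have : IsFiniteMeasure (volume.restrict (dyadicCube u j m)) :=
    ⟨by simpa using (volume_dyadicCube_ne_top u j m).lt_top⟩
  rw [meanZeroPart, integral_indicator (measurableSet_dyadicCube u j m)]
  exact integral_sub_average _ _

theorem enorm_average_le (f : EuclideanSpace ℝ (Fin d) → E)
    (Q : Set (EuclideanSpace ℝ (Fin d))) :
    ‖⨍ z in Q, f z‖ₑ ≤ (∫⁻ z in Q, ‖f z‖ₑ) / volume Q := by
  rw [← setLAverage_eq]
  exact enorm_integral_le_lintegral_enorm _

theorem lintegral_enorm_meanZeroPart_le (hf : AEStronglyMeasurable f volume)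
    (u : Fin d → Fin 3) (j : ℤ) (m : Fin d → ℤ) :
    ∫⁻ y, ‖meanZeroPart f (dyadicCube u j m) y‖ₑ ≤
      2 * ∫⁻ y in dyadicCube u j m, ‖f y‖ₑ := by
  calc ∫⁻ y, ‖meanZeroPart f (dyadicCube u j m) y‖ₑ
      = ∫⁻ y in dyadicCube u j m, ‖f y - ⨍ z in dyadicCube u j m, f z‖ₑ := by
        rw [← lintegral_indicator (measurableSet_dyadicCube u j m)]
        refine lintegral_congr fun y => ?_
        rw [meanZeroPart, enorm_indicator_eq_indicator_enorm]
    _ ≤ ∫⁻ y in dyadicCube u j m, (‖f y‖ₑ + (∫⁻ z in dyadicCube u j m, ‖f z‖ₑ) /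
          volume (dyadicCube u j m)) :=
        lintegral_mono fun y => enorm_sub_le.trans (by gcongr; exact enorm_average_le _ _)
    _ = 2 * ∫⁻ y in dyadicCube u j m, ‖f y‖ₑ := by
        rw [lintegral_add_left' hf.enorm.restrict, setLIntegral_const,
          ENNReal.div_mul_cancel (volume_dyadicCube_ne_zero u j m)
            (volume_dyadicCube_ne_top u j m), two_mul]

end MeanZero

/-- The constant in the weak type estimate. -/
noncomputable def weakTypeConst (d : ℕ) (α B : ℝ) : ℝ≥0∞ :=
  4 + ENNReal.ofReal ((4 * d) ^ d) * volume (ball (0 : EuclideanSpace ℝ (Fin d)) 1) * 2 ^ d +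
    ENNReal.ofReal B * (ENNReal.ofReal (2 ^ d * (1 - 2 ^ (-α))⁻¹) *
        volume (ball (0 : EuclideanSpace ℝ (Fin d)) 1)) * 2

theorem weakTypeConst_ne_top (d : ℕ) (α B : ℝ) : weakTypeConst d α B ≠ ∞ := by
  have h : volume (ball (0 : EuclideanSpace ℝ (Fin d)) 1) ≠ ∞ := measure_ball_lt_top.ne
  unfold weakTypeConst
  finiteness

theorem weakTypeConst_ne_zero (d : ℕ) (α B : ℝ) : weakTypeConst d α B ≠ 0 := by
  unfold weakTypeConst
  simp

/-- Trades an `L^q` integral of a function bounded by `τ` for its `L^1` norm. The spare summand `N`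
lets the bound be combined with a cruder one on a small set. -/
theorem rpow_le_add_of_le {x τ N : ℝ≥0∞} {q : ℝ} (hq : 1 ≤ q) (h : x ≤ τ) :
    x ^ q ≤ τ ^ (q - 1) * x + N := by
  refine le_trans ?_ le_self_add
  calc x ^ q = x ^ ((q - 1) + 1) := by rw [sub_add_cancel]
    _ = x ^ (q - 1) * x := by
        rw [ENNReal.rpow_add_of_nonneg _ _ (by linarith) zero_le_one, ENNReal.rpow_one]
    _ ≤ _ := by gcongr

section Operator

variable {d : ℕ} {E : Type*} [NormedAddCommGroup E] [NormedSpace ℝ E]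
  {p : ℝ≥0∞} [Fact (1 ≤ p)] {α A B : ℝ}
  {T : Lp E p (volume : Measure (EuclideanSpace ℝ (Fin d))) →L[ℝ]
    Lp E p (volume : Measure (EuclideanSpace ℝ (Fin d)))}
  {f : EuclideanSpace ℝ (Fin d) → E}

/-- The good part of a Calderón-Zygmund decomposition with finitely many selected cubes: the cubes
that are not selected are negligible. -/
theorem exists_good_part (hp : p ≠ ∞) (hf : IsBddCompactlySupported f)
    (hI : ∫⁻ y, ‖f y‖ₑ ≠ 0)
    {u : Fin d → Fin 3} {σ τ : ℝ≥0∞} (hτ : τ ≠ 0) (hτ' : τ ≠ ∞) (hσ : 2 ^ d * σ = τ)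
    {P : Set (ℤ × (Fin d → ℤ))} (hP : IsStoppingFamily f u σ P) :
    ∃ s : Finset P, ∫⁻ x, ‖((hf.memLp p).toLp f - ∑ i ∈ s,
      ((hf.meanZeroPart u i.1.1 i.1.2).memLp p).toLp _ : Lp E p volume) x‖ₑ ^ p.toReal ≤
        4 * (τ ^ (p.toReal - 1) * ∫⁻ y, ‖f y‖ₑ) := by
  have hp1 : (1 : ℝ≥0∞) ≤ p := Fact.out
  have hpr : 1 ≤ p.toReal := by
    rw [← ENNReal.toReal_one]
    exact ENNReal.toReal_mono hp hp1
  have hI' : ∫⁻ y, ‖f y‖ₑ ≠ ∞ := hf.integrable.2.ne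
  obtain ⟨M, hM⟩ := hf.bounded
  have hM' : ∀ x, ‖f x‖ₑ ≤ ENNReal.ofReal M := fun x => by
    rw [← ofReal_norm]
    exact ENNReal.ofReal_le_ofReal (hM x)
  set N : ℝ≥0∞ := ENNReal.ofReal M ^ p.toReal with hN
  have hNt : N ≠ ∞ := ENNReal.rpow_ne_top_of_nonneg (by linarith) ENNReal.ofReal_ne_top
  set δ : ℝ≥0∞ := τ ^ (p.toReal - 1) * ∫⁻ y, ‖f y‖ₑ with hδ
  have hδ0 : δ ≠ 0 := mul_ne_zero (ENNReal.rpow_pos (pos_iff_ne_zero.2 hτ) hτ').ne' hI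
  have hστ : σ ≤ τ := by
    rw [← hσ]
    exact le_mul_of_one_le_left zero_le (one_le_pow₀ one_le_two)
  have hσ0 : σ ≠ 0 := fun h => hτ (by rw [← hσ, h, mul_zero])
  have hσt : σ ≠ ∞ := (hστ.trans_lt hτ'.lt_top).ne
  have hsum : ∑' i : P, volume (dyadicCube u i.1.1 i.1.2) ≠ ∞ := by
    intro h
    have := hP.tsum_le
    rw [h, ENNReal.mul_top hσ0, top_le_iff] at this
    exact hI' this
  -- The stopping cubes have finite total measure, so finitely many of them leave out less than `δ /
  -- N`. There `‖f‖ ^ p ≤ N`, and the omitted cubes contribute at most `δ` to the `L^p` integral.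
  obtain ⟨s, hs⟩ := ((ENNReal.tendsto_tsum_compl_atTop_zero hsum).eventually_lt_const
    (ENNReal.div_pos hδ0 hNt)).exists
  refine ⟨s, ?_⟩
  set G : Lp E p (volume : Measure (EuclideanSpace ℝ (Fin d))) :=
    (hf.memLp p).toLp f - ∑ i ∈ s, ((hf.meanZeroPart u i.1.1 i.1.2).memLp p).toLp _ with hG
  have hGae : ∀ᵐ x, G x = f x - ∑ i ∈ s, meanZeroPart f (dyadicCube u i.1.1 i.1.2) x := by
    have h1 : ∀ᵐ x, ∀ i : P, ((hf.meanZeroPart u i.1.1 i.1.2).memLp p).toLp _ x =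
        meanZeroPart f (dyadicCube u i.1.1 i.1.2) x :=
      ae_all_iff.2 fun i => MemLp.coeFn_toLp _
    filter_upwards [h1, Lp.coeFn_sub ((hf.memLp p).toLp f)
      (∑ i ∈ s, ((hf.meanZeroPart u i.1.1 i.1.2).memLp p).toLp _), MemLp.coeFn_toLp (hf.memLp p),
      Lp.coeFn_finsetSum s fun i : P => ((hf.meanZeroPart u i.1.1 i.1.2).memLp p).toLp _]
      with x h1 h2 h3 h4
    rw [hG, h2, Pi.sub_apply, h3, h4, Finset.sum_apply]
    exact congrArg _ (Finset.sum_congr rfl fun i _ => h1 i)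
  set R : Set (EuclideanSpace ℝ (Fin d)) := ⋃ i : {i : P // i ∉ s},
    dyadicCube u i.1.1.1 i.1.1.2 with hR
  have hRm : MeasurableSet R := MeasurableSet.iUnion fun i => measurableSet_dyadicCube _ _ _
  -- Three cases: on a selected cube `G` is the mean of `f`, at most `2^d σ = τ`; on an omitted cube
  -- `G = f` is bounded by the supremum; elsewhere `G = f` is at most `σ ≤ τ`.
  have hpt : ∀ᵐ x, ‖G x‖ₑ ^ p.toReal ≤
      τ ^ (p.toReal - 1) * ‖G x‖ₑ + R.indicator (fun _ => N) x := by
    filter_upwards [hGae, hP.ae_le] with x hx hx'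
    by_cases hxs : ∃ i ∈ s, x ∈ dyadicCube u i.1.1 i.1.2
    · obtain ⟨i, his, hi⟩ := hxs
      have h1 : G x = ⨍ z in dyadicCube u i.1.1 i.1.2, f z := by
        rw [hx, Finset.sum_eq_single_of_mem i his, meanZeroPart, indicator_of_mem hi, sub_sub_cancel]
        intro k _ hk
        refine indicator_of_notMem (fun hk' => ?_) _
        exact disjoint_left.1 (hP.disjoint k.2 i.2 fun h => hk (Subtype.ext h)) hk' hi
      refine rpow_le_add_of_le hpr ?_
      rw [h1]
      refine (enorm_average_le _ _).trans (ENNReal.div_le_of_le_mul ?_)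
      rw [← hσ, mul_assoc]
      exact hP.le i i.2
    · have h1 : G x = f x := by
        rw [hx, Finset.sum_eq_zero, sub_zero]
        intro i hi
        exact indicator_of_notMem (fun h => hxs ⟨i, hi, h⟩) _
      by_cases hxR : x ∈ R
      · rw [indicator_of_mem hxR, h1]
        refine le_trans ?_ le_add_self
        exact ENNReal.rpow_le_rpow (hM' x) (by linarith)
      · refine rpow_le_add_of_le hpr ?_
        rw [h1]
        refine (hx' fun i hi hxi => ?_).trans hστ
        by_cases his : (⟨i, hi⟩ : P) ∈ s
        · exact hxs ⟨_, his, hxi⟩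
        · exact hxR (mem_iUnion.2 ⟨⟨⟨i, hi⟩, his⟩, hxi⟩)
  have hG1 : ∫⁻ x, ‖G x‖ₑ ≤ 3 * ∫⁻ y, ‖f y‖ₑ := by
    calc ∫⁻ x, ‖G x‖ₑ
        ≤ ∫⁻ x, (‖f x‖ₑ + ∑ i ∈ s, ‖meanZeroPart f (dyadicCube u i.1.1 i.1.2) x‖ₑ) := by
          refine lintegral_mono_ae ?_
          filter_upwards [hGae] with x hx
          rw [hx]
          exact enorm_sub_le.trans (by gcongr; exact enorm_sum_le _ _)
      _ = (∫⁻ x, ‖f x‖ₑ) + ∑ i ∈ s, ∫⁻ x, ‖meanZeroPart f (dyadicCube u i.1.1 i.1.2) x‖ₑ := by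
          rw [lintegral_add_left' hf.aestronglyMeasurable.enorm, lintegral_finsetSum']
          exact fun i _ => (hf.meanZeroPart u i.1.1 i.1.2).aestronglyMeasurable.enorm
      _ ≤ (∫⁻ x, ‖f x‖ₑ) + ∑ i ∈ s, 2 * ∫⁻ x in dyadicCube u i.1.1 i.1.2, ‖f x‖ₑ := by
          gcongr
          exact lintegral_enorm_meanZeroPart_le hf.aestronglyMeasurable _ _ _
      _ ≤ (∫⁻ x, ‖f x‖ₑ) + 2 * ∫⁻ x, ‖f x‖ₑ := by
          rw [← Finset.mul_sum]
          gcongr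
          exact hP.sum_setLIntegral_le s
      _ = 3 * ∫⁻ y, ‖f y‖ₑ := by ring
  calc ∫⁻ x, ‖G x‖ₑ ^ p.toReal
      ≤ ∫⁻ x, (τ ^ (p.toReal - 1) * ‖G x‖ₑ + R.indicator (fun _ => N) x) := lintegral_mono_ae hpt
    _ = τ ^ (p.toReal - 1) * (∫⁻ x, ‖G x‖ₑ) + N * volume R := by
        rw [lintegral_add_right _ (measurable_const.indicator hRm), lintegral_indicator_const hRm,
          lintegral_const_mul'' _ (Lp.aestronglyMeasurable G).enorm]
    _ ≤ τ ^ (p.toReal - 1) * (3 * ∫⁻ y, ‖f y‖ₑ) + δ := by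
        gcongr
        rw [mul_comm]
        refine ENNReal.mul_le_of_le_div ((measure_iUnion_le _).trans ?_)
        exact hs.le
    _ = 4 * δ := by rw [hδ]; ring

/-- Calderón–Zygmund decomposition: the good part is handled by the `L^p` bound and Chebyshev, the
mean-zero parts by their decay outside balls around the cubes, and the balls have small total
measure. Only finitely many cubes are selected, so `T` is applied to a finite sum and no convergence
of the bad part in `L^p` is needed. -/
theorem IsCalderonZygmund.weak_type [CompleteSpace E] (hd : 0 < d) (hp : p ≠ ∞) (hα : 0 < α)
    (hA : 0 < A) (hB : 0 ≤ B) (hT : IsCalderonZygmund α A B T) (hf : IsBddCompactlySupported f)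
    {τ : ℝ≥0∞} (hτ : τ ≠ 0) (hτ' : τ ≠ ∞) :
    τ * volume {x | (ENNReal.ofReal A + 1) * τ < ‖T ((hf.memLp p).toLp f) x‖ₑ} ≤
      weakTypeConst d α B * ∫⁻ y, ‖f y‖ₑ := by
  by_cases hI : ∫⁻ y, ‖f y‖ₑ = 0
  · rw [hI, mul_zero, nonpos_iff_eq_zero, mul_eq_zero]
    right
    rw [lintegral_eq_zero_iff' hf.aestronglyMeasurable.enorm] at hI
    have h0 : (hf.memLp p).toLp f = 0 := by
      refine (Lp.eq_zero_iff_ae_eq_zero).2 ((hf.memLp p).coeFn_toLp.trans ?_)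
      filter_upwards [hI] with x hx
      simpa using hx
    rw [h0, map_zero]
    refine measure_mono_null (fun x hx => ?_) (ae_iff.1 (Lp.coeFn_zero E p volume))
    refine fun hx' => ?_
    rw [mem_ofPred_eq, hx'] at hx
    simp at hx
  -- One arbitrary system is enough here. The stopping level `σ` is smaller than `τ` by the factor
  -- `2^d` lost in passing to the parent, so that the means on stopping cubes are at most `τ`.
  set u : Fin d → Fin 3 := fun _ => 0
  set σ : ℝ≥0∞ := τ / 2 ^ d with hσd
  have h2 : (2 : ℝ≥0∞) ^ d ≠ 0 := by positivity
  have h2' : (2 : ℝ≥0∞) ^ d ≠ ∞ := by finiteness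
  have hσ : 2 ^ d * σ = τ := ENNReal.mul_div_cancel h2 h2'
  have hσ0 : σ ≠ 0 := fun h => hτ (by rw [← hσ, h, mul_zero])
  have hσt : σ ≠ ∞ := ENNReal.div_ne_top hτ' h2
  obtain ⟨P, hP⟩ := exists_isStoppingFamily hd hf.integrable u hσ0 hσt
  obtain ⟨s, hs⟩ := exists_good_part hp hf hI hτ hτ' hσ hP
  set b : P → Lp E p (volume : Measure (EuclideanSpace ℝ (Fin d))) := fun i =>
    ((hf.meanZeroPart u i.1.1 i.1.2).memLp p).toLp _ with hb
  set G : Lp E p (volume : Measure (EuclideanSpace ℝ (Fin d))) :=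
    (hf.memLp p).toLp f - ∑ i ∈ s, b i with hG
  set D : P → Set (EuclideanSpace ℝ (Fin d)) := fun i =>
    closedBall (dyadicCorner u i.1.1 i.1.2) (4 * dyadicRadius d i.1.1) with hD
  set U : Set (EuclideanSpace ℝ (Fin d)) := ⋃ i ∈ s, D i with hU
  have hUm : MeasurableSet U := Finset.measurableSet_biUnion _ fun i _ => measurableSet_closedBall
  have hgood : τ * volume {x | ENNReal.ofReal A * τ ≤ ‖T G x‖ₑ} ≤ 4 * ∫⁻ y, ‖f y‖ₑ := by
    have h := (hT.rpow_mul_volume_le hp hA G (τ := τ)).trans hs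
    have h0 : τ ^ (p.toReal - 1) ≠ 0 := (ENNReal.rpow_pos (pos_iff_ne_zero.2 hτ) hτ').ne'
    have h1 : τ ^ (p.toReal - 1) ≠ ∞ := ENNReal.rpow_ne_top_of_ne_zero hτ hτ'
    rw [← ENNReal.mul_le_mul_iff_right h0 h1]
    calc τ ^ (p.toReal - 1) * (τ * volume {x | ENNReal.ofReal A * τ ≤ ‖T G x‖ₑ})
        = τ ^ p.toReal * volume {x | ENNReal.ofReal A * τ ≤ ‖T G x‖ₑ} := by
          rw [← mul_assoc]
          congr 1
          nth_rw 2 [← ENNReal.rpow_one τ]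
          rw [← ENNReal.rpow_add _ _ hτ hτ', sub_add_cancel]
      _ ≤ _ := h
      _ = _ := by ring
  have hexc : τ * volume U ≤ ENNReal.ofReal ((4 * d) ^ d) *
      volume (ball (0 : EuclideanSpace ℝ (Fin d)) 1) * 2 ^ d * ∫⁻ y, ‖f y‖ₑ := by
    calc τ * volume U ≤ τ * ∑ i ∈ s, volume (D i) := by
          gcongr
          exact measure_biUnion_finset_le s _
      _ = ENNReal.ofReal ((4 * d) ^ d) * volume (ball (0 : EuclideanSpace ℝ (Fin d)) 1) * 2 ^ d *
            (σ * ∑ i ∈ s, volume (dyadicCube u i.1.1 i.1.2)) := by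
          simp only [hD, volume_closedBall_dyadicCorner]
          rw [← Finset.mul_sum, ← hσ]
          ring
      _ ≤ _ := by
          gcongr
          refine le_trans ?_ hP.tsum_le
          gcongr
          exact ENNReal.sum_le_tsum s
  have hbad : τ * volume {x | x ∈ Uᶜ ∧ τ ≤ ‖T (∑ i ∈ s, b i) x‖ₑ} ≤
      ENNReal.ofReal B * (ENNReal.ofReal (2 ^ d * (1 - 2 ^ (-α))⁻¹) *
        volume (ball (0 : EuclideanSpace ℝ (Fin d)) 1)) * 2 * ∫⁻ y, ‖f y‖ₑ := by
    calc τ * volume {x | x ∈ Uᶜ ∧ τ ≤ ‖T (∑ i ∈ s, b i) x‖ₑ}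
        = τ * volume.restrict Uᶜ {x | τ ≤ ‖T (∑ i ∈ s, b i) x‖ₑ} := by
          rw [Measure.restrict_apply' hUm.compl, inter_comm]
          rfl
      _ ≤ ∫⁻ x in Uᶜ, ‖T (∑ i ∈ s, b i) x‖ₑ :=
          mul_meas_ge_le_lintegral₀ (Lp.aestronglyMeasurable _).enorm.restrict _
      _ ≤ ∫⁻ x in Uᶜ, ∑ i ∈ s, ‖T (b i) x‖ₑ := by
          refine lintegral_mono_ae (ae_restrict_of_ae ?_)
          filter_upwards [Lp.coeFn_finsetSum s fun i => T (b i)] with x hx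
          rw [map_sum, hx, Finset.sum_apply]
          exact enorm_sum_le _ _
      _ = ∑ i ∈ s, ∫⁻ x in Uᶜ, ‖T (b i) x‖ₑ :=
          lintegral_finsetSum' _ fun i _ => (Lp.aestronglyMeasurable _).enorm.restrict
      _ ≤ ∑ i ∈ s, ENNReal.ofReal B * (ENNReal.ofReal (2 ^ d * (1 - 2 ^ (-α))⁻¹) *
            volume (ball (0 : EuclideanSpace ℝ (Fin d)) 1)) *
              (2 * ∫⁻ y in dyadicCube u i.1.1 i.1.2, ‖f y‖ₑ) := by
          refine Finset.sum_le_sum fun i hi => ?_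
          have hsub : Uᶜ ⊆ (D i)ᶜ := compl_subset_compl.2 (subset_biUnion_of_mem (u := D) hi)
          refine (lintegral_mono_set hsub).trans ?_
          refine (hT.setLIntegral_enorm_le hα hB (by have := dyadicRadius_pos hd i.1.1; positivity)
            (hf.meanZeroPart u i.1.1 i.1.2) (fun y hy => ?_)
            (integral_meanZeroPart f u i.1.1 i.1.2)).trans ?_
          · refine indicator_of_notMem (fun h => hy ?_) _
            rw [mul_div_cancel_left₀ _ (by norm_num)]
            exact dyadicCube_subset_closedBall (dyadicCorner_mem _ _ _) h
          · gcongr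
            exact lintegral_enorm_meanZeroPart_le hf.aestronglyMeasurable _ _ _
      _ ≤ _ := by
          rw [← Finset.mul_sum, ← Finset.mul_sum, ← mul_assoc]
          gcongr
          exact hP.sum_setLIntegral_le s
  -- If `T f` exceeds `(A + 1) τ`, then `T G` reaches `A τ` or the operator applied to the bad part
  -- reaches `τ`.
  have hsplit : volume {x | (ENNReal.ofReal A + 1) * τ < ‖T ((hf.memLp p).toLp f) x‖ₑ} ≤
      volume {x | ENNReal.ofReal A * τ ≤ ‖T G x‖ₑ} + volume U +
        volume {x | x ∈ Uᶜ ∧ τ ≤ ‖T (∑ i ∈ s, b i) x‖ₑ} := by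
    refine le_trans (measure_mono_ae ?_) ((measure_union_le _ _).trans
      (add_le_add_left (measure_union_le _ _) _))
    have hsum : T ((hf.memLp p).toLp f) = T G + T (∑ i ∈ s, b i) := by
      rw [← map_add, hG, sub_add_cancel]
    filter_upwards [Lp.coeFn_add (T G) (T (∑ i ∈ s, b i))] with x hx hx'
    by_contra hcon
    have hcon1 : ¬ (ENNReal.ofReal A * τ ≤ ‖T G x‖ₑ) := fun h => hcon (Or.inl (Or.inl h))
    have hcon2 : x ∉ U := fun h => hcon (Or.inl (Or.inr h))
    have hcon3 : ¬ (τ ≤ ‖T (∑ i ∈ s, b i) x‖ₑ) := fun h => hcon (Or.inr ⟨hcon2, h⟩)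
    have hx2 : (ENNReal.ofReal A + 1) * τ < ‖T ((hf.memLp p).toLp f) x‖ₑ := hx'
    refine hx2.not_ge ?_
    rw [hsum, hx, Pi.add_apply, add_mul, one_mul]
    exact (enorm_add_le _ _).trans (add_le_add (not_le.1 hcon1).le (not_le.1 hcon3).le)
  calc τ * volume {x | (ENNReal.ofReal A + 1) * τ < ‖T ((hf.memLp p).toLp f) x‖ₑ}
      ≤ τ * (volume {x | ENNReal.ofReal A * τ ≤ ‖T G x‖ₑ} + volume U +
        volume {x | x ∈ Uᶜ ∧ τ ≤ ‖T (∑ i ∈ s, b i) x‖ₑ}) := by gcongr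
    _ ≤ 4 * (∫⁻ y, ‖f y‖ₑ) + ENNReal.ofReal ((4 * d) ^ d) *
          volume (ball (0 : EuclideanSpace ℝ (Fin d)) 1) * 2 ^ d * (∫⁻ y, ‖f y‖ₑ) +
        ENNReal.ofReal B * (ENNReal.ofReal (2 ^ d * (1 - 2 ^ (-α))⁻¹) *
          volume (ball (0 : EuclideanSpace ℝ (Fin d)) 1)) * 2 * ∫⁻ y, ‖f y‖ₑ := by
        rw [mul_add, mul_add]
        gcongr
    _ = _ := by
        rw [weakTypeConst]
        ring

end Operator

/-! ### The local step of the sparse domination -/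

/-- The ball around a dyadic cube to which functions are localized. -/
noncomputable def dyadicBall {d : ℕ} (u : Fin d → Fin 3) (i : ℤ × (Fin d → ℤ)) :
    Set (EuclideanSpace ℝ (Fin d)) :=
  closedBall (dyadicCorner u i.1 i.2) (4 * dyadicRadius d i.1)

theorem measurableSet_dyadicBall {d : ℕ} (u : Fin d → Fin 3) (i : ℤ × (Fin d → ℤ)) :
    MeasurableSet (dyadicBall u i) := measurableSet_closedBall

theorem dyadicCube_subset_dyadicBall {d : ℕ} (u : Fin d → Fin 3) (i : ℤ × (Fin d → ℤ)) :
    dyadicCube u i.1 i.2 ⊆ dyadicBall u i := by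
  refine (dyadicCube_subset_closedBall (dyadicCorner_mem u i.1 i.2)).trans
    (closedBall_subset_closedBall ?_)
  have : 0 ≤ dyadicRadius d i.1 := by unfold dyadicRadius; positivity
  linarith

/-- The radius at least halves and the centres are at most one `dyadicRadius` of the larger cube
apart; `2 + 1 ≤ 4`. Hence localizing to the larger ball first does not affect the localization to
the smaller one. -/
theorem dyadicBall_subset {d : ℕ} {u : Fin d → Fin 3} {i k : ℤ × (Fin d → ℤ)} (h : i.1 < k.1)
    (hsub : dyadicCube u k.1 k.2 ⊆ dyadicCube u i.1 i.2) : dyadicBall u k ⊆ dyadicBall u i := by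
  refine closedBall_subset_closedBall' ?_
  have h1 := dist_le_dyadicRadius (hsub (dyadicCorner_mem u k.1 k.2)) (dyadicCorner_mem u i.1 i.2)
  have h2 : 2 * dyadicRadius d k.1 ≤ dyadicRadius d i.1 := by
    unfold dyadicRadius
    have : (2 : ℝ) * 2 ^ (-k.1) ≤ 2 ^ (-i.1) := by
      rw [← zpow_one_add₀ two_ne_zero]
      exact zpow_le_zpow_right₀ one_le_two (by omega)
    nlinarith [Nat.cast_nonneg (α := ℝ) d]
  have h3 : 0 ≤ dyadicRadius d i.1 := by unfold dyadicRadius; positivity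
  linarith

/-- The average of `‖f‖` over the ball around a cube, normalized with the measure of the cube. -/
noncomputable def ballAverage {d : ℕ} {E : Type*} [NormedAddCommGroup E]
    (f : EuclideanSpace ℝ (Fin d) → E) (u : Fin d → Fin 3) (i : ℤ × (Fin d → ℤ)) : ℝ≥0∞ :=
  (∫⁻ y in dyadicBall u i, ‖f y‖ₑ) / volume (dyadicCube u i.1 i.2)

theorem mul_le_of_mul_mul_le {a c v w : ℝ≥0∞} (ha : a ≠ 0) (ha' : a ≠ ∞)
    (h : c * a * v ≤ a * w) : c * v ≤ w := by
  rw [mul_comm c, mul_assoc] at h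
  exact (ENNReal.mul_le_mul_iff_right ha ha').1 h

/-- Few stopping cubes of the indicator function of a small set are needed to cover it. -/
theorem exists_stopping_of_small_set {d : ℕ} (hd : 0 < d) (u : Fin d → Fin 3)
    (i : ℤ × (Fin d → ℤ)) {Ω : Set (EuclideanSpace ℝ (Fin d))} (hΩ : MeasurableSet Ω)
    (hvol : 2 ^ (d + 2) * volume Ω ≤ volume (dyadicCube u i.1 i.2)) :
    ∃ C : Set (ℤ × (Fin d → ℤ)), (C.PairwiseDisjoint fun k => dyadicCube u k.1 k.2) ∧
      (∀ k ∈ C, i.1 < k.1 ∧ dyadicCube u k.1 k.2 ⊆ dyadicCube u i.1 i.2) ∧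
      2 * ∑' k : C, volume (dyadicCube u k.1.1 k.1.2) ≤ volume (dyadicCube u i.1 i.2) ∧
      (∀ k ∈ C, 2 * volume (Ω ∩ dyadicCube u k.1 k.2) ≤ volume (dyadicCube u k.1 k.2)) ∧
      ∀ᵐ x, x ∈ dyadicCube u i.1 i.2 → (∀ k ∈ C, x ∉ dyadicCube u k.1 k.2) → x ∉ Ω := by
  set Q := dyadicCube u i.1 i.2 with hQ
  have hQm : MeasurableSet Q := measurableSet_dyadicCube u i.1 i.2
  have hm : MeasurableSet (Ω ∩ Q) := hΩ.inter hQm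
  have hfin : volume (Ω ∩ Q) ≠ ∞ :=
    measure_ne_top_of_subset inter_subset_right (volume_dyadicCube_ne_top u i.1 i.2)
  have h20 : (2 : ℝ≥0∞) ^ (d + 1) ≠ 0 := by positivity
  have h2t : (2 : ℝ≥0∞) ^ (d + 1) ≠ ∞ := by finiteness
  have hint : Integrable ((Ω ∩ Q).indicator fun _ => (1 : ℝ)) volume :=
    (integrable_indicator_iff hm).2 (integrableOn_const hfin)
  -- With this level, the upper bound on stopping cubes gives density of `Ω` at most `2^d / 2^(d+1)
  -- = 1/2`, and their total measure is at most `2^(d+1) |Ω|`, which is at most half of `Q`.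
  obtain ⟨C, hC⟩ := exists_isStoppingFamily hd hint u (τ := (2 ^ (d + 1))⁻¹)
    (ENNReal.inv_ne_zero.2 h2t) (ENNReal.inv_ne_top.2 h20)
  have henorm : ∀ x, ‖(Ω ∩ Q).indicator (fun _ => (1 : ℝ)) x‖ₑ =
      (Ω ∩ Q).indicator (fun _ => (1 : ℝ≥0∞)) x := fun x => by
    rw [enorm_indicator_eq_indicator_enorm]
    simp
  have hI : ∀ R : Set (EuclideanSpace ℝ (Fin d)),
      ∫⁻ y in R, ‖(Ω ∩ Q).indicator (fun _ => (1 : ℝ)) y‖ₑ = volume (Ω ∩ Q ∩ R) := fun R => by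
    simp only [henorm]
    rw [lintegral_indicator_const hm, one_mul, Measure.restrict_apply hm]
  have hsub : ∀ k ∈ C, i.1 < k.1 ∧ dyadicCube u k.1 k.2 ⊆ Q := by
    intro k hk
    have h1 := hC.lt k hk
    rw [hI, ← ENNReal.div_eq_inv_mul, ENNReal.div_lt_iff (Or.inl h20) (Or.inl h2t)] at h1
    have h3 : (Ω ∩ Q ∩ dyadicCube u k.1 k.2).Nonempty := by
      refine nonempty_of_measure_ne_zero (μ := volume) fun h => ?_
      rw [h, zero_mul] at h1
      exact not_lt_zero h1
    obtain ⟨x, ⟨-, hxQ⟩, hxk⟩ := h3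
    have hlt : i.1 < k.1 := by
      -- A stopping cube at least as large as `Q` would contain `Q`, forcing `|Q| < 2^(d+1) |Ω|`
      -- against the smallness of `Ω`.
      by_contra! hle
      have h4 : volume Q ≤ volume (dyadicCube u k.1 k.2) :=
        measure_mono (dyadicCube_subset_of_le hxQ hxk hle)
      refine (h4.trans_lt h1).not_ge (le_trans ?_ hvol)
      rw [pow_succ _ (d + 1), mul_comm _ ((2 : ℝ≥0∞) ^ (d + 1)), mul_assoc]
      gcongr
      refine le_trans (measure_mono (inter_subset_left.trans inter_subset_left)) ?_
      exact le_mul_of_one_le_left zero_le one_le_two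
    exact ⟨hlt, dyadicCube_subset_of_le hxk hxQ hlt.le⟩
  refine ⟨C, hC.disjoint, hsub, ?_, fun k hk => ?_, ?_⟩
  · have h1 := hC.tsum_le
    have h2 := hI univ
    rw [Measure.restrict_univ, inter_univ] at h2
    rw [h2, ← ENNReal.div_eq_inv_mul, ENNReal.div_le_iff h20 h2t] at h1
    refine le_trans ?_ hvol
    rw [pow_succ _ (d + 1), mul_comm _ (2 : ℝ≥0∞), mul_assoc]
    gcongr
    rw [mul_comm]
    refine h1.trans ?_
    gcongr
    exact inter_subset_left
  · have h1 := hC.le k hk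
    rw [hI, inter_assoc, inter_eq_right.2 (hsub k hk).2] at h1
    refine (mul_le_mul_right h1 2).trans_eq ?_
    rw [← mul_assoc, ← pow_succ', ← mul_assoc, ENNReal.mul_inv_cancel h20 h2t, one_mul]
  · filter_upwards [hC.ae_le] with x hx hxQ hxC hxΩ
    have h1 := hx hxC
    rw [henorm, indicator_of_mem (show x ∈ Ω ∩ Q from ⟨hxΩ, hxQ⟩), ENNReal.one_le_inv] at h1
    exact ENNReal.one_lt_two.not_ge
      ((le_self_pow₀ one_le_two (Nat.succ_ne_zero d)).trans h1)

/-! ### Exceptional sets, comparison of localizations, and the recursive step. -/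

section Operator

variable {d : ℕ} {E : Type*} [NormedAddCommGroup E] [NormedSpace ℝ E] [CompleteSpace E]
  {p : ℝ≥0∞} [Fact (1 ≤ p)] {α A B : ℝ}
  {T : Lp E p (volume : Measure (EuclideanSpace ℝ (Fin d))) →L[ℝ]
    Lp E p (volume : Measure (EuclideanSpace ℝ (Fin d)))}
  {f : EuclideanSpace ℝ (Fin d) → E}

/-- Outside a small set, both `T F` and the dyadic maximal functions of `F` are controlled. -/
theorem IsCalderonZygmund.exists_exceptional_set (hd : 0 < d) (hp : p ≠ ∞) (hα : 0 < α)
    (hA : 0 < A) (hB : 0 ≤ B) (hT : IsCalderonZygmund α A B T) (hf : IsBddCompactlySupported f)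
    {L V : ℝ≥0∞} (hL : L ≠ 0) (hL' : L ≠ ∞) (hLV : ∫⁻ y, ‖f y‖ₑ ≤ L * V) :
    ∃ Ω : Set (EuclideanSpace ℝ (Fin d)), MeasurableSet Ω ∧ 2 ^ (d + 2) * volume Ω ≤ V ∧
      (∀ x, x ∉ Ω → ‖T ((hf.memLp p).toLp f) x‖ₑ ≤
        (ENNReal.ofReal A + 1) * (2 ^ (d + 3) * weakTypeConst d α B * L)) ∧
      ∀ x, x ∉ Ω → ∀ u j m, x ∈ dyadicCube u j m →
        ∫⁻ y in dyadicCube u j m, ‖f y‖ₑ ≤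
          3 ^ d * 2 ^ (d + 3) * L * volume (dyadicCube u j m) := by
  have hW0 := weakTypeConst_ne_zero d α B
  have hWt := weakTypeConst_ne_top d α B
  -- The levels make each of the two exceptional sets at most `V / 2^(d+3)`. The factor `3^d` in the
  -- second one pays for the union over all translated systems.
  have h1 : 2 ^ (d + 3) * weakTypeConst d α B * L ≠ 0 := by simp [hL, hW0]
  have h2 : 2 ^ (d + 3) * weakTypeConst d α B * L ≠ ∞ := by finiteness
  have h3 : 3 ^ d * 2 ^ (d + 3) * L ≠ 0 := by simp [hL]
  have h4 : 3 ^ d * 2 ^ (d + 3) * L ≠ ∞ := by finiteness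
  have hweak := hT.weak_type hd hp hα hA hB hf h1 h2
  choose U hUm hUv hU using fun u => volume_dyadicMaximal_le hd hf.integrable u h3 h4
  set Ω₁ : Set (EuclideanSpace ℝ (Fin d)) := {x | (ENNReal.ofReal A + 1) *
    (2 ^ (d + 3) * weakTypeConst d α B * L) < ‖T ((hf.memLp p).toLp f) x‖ₑ} with hΩ₁
  have hΩ₁m : MeasurableSet Ω₁ :=
    measurableSet_lt measurable_const (Lp.stronglyMeasurable _).enorm
  have hv1 : 2 ^ (d + 3) * volume Ω₁ ≤ V := by
    refine mul_le_of_mul_mul_le (a := weakTypeConst d α B * L) (mul_ne_zero hW0 hL)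
      (ENNReal.mul_ne_top hWt hL') ?_
    rw [← mul_assoc]
    refine hweak.trans ?_
    rw [mul_assoc]
    gcongr
  have hv2 : 2 ^ (d + 3) * volume (⋃ u, U u) ≤ V := by
    have h5 : ∀ u, 3 ^ d * 2 ^ (d + 3) * volume (U u) ≤ V := fun u =>
      mul_le_of_mul_mul_le hL hL' ((hUv u).trans hLV)
    have h30 : (3 : ℝ≥0∞) ^ d ≠ 0 := by positivity
    have h3t : (3 : ℝ≥0∞) ^ d ≠ ∞ := by finiteness
    rw [← ENNReal.mul_le_mul_iff_right h30 h3t]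
    calc 3 ^ d * (2 ^ (d + 3) * volume (⋃ u, U u))
        ≤ 3 ^ d * (2 ^ (d + 3) * ∑ u, volume (U u)) := by
          gcongr
          exact measure_iUnion_fintype_le _ _
      _ = ∑ u, 3 ^ d * 2 ^ (d + 3) * volume (U u) := by
          rw [← mul_assoc, Finset.mul_sum]
      _ ≤ ∑ u : Fin d → Fin 3, V := Finset.sum_le_sum fun u _ => h5 u
      _ = 3 ^ d * V := by simp
  refine ⟨Ω₁ ∪ ⋃ u, U u, hΩ₁m.union (MeasurableSet.iUnion hUm), ?_,
    fun x hx => not_lt.1 fun h => hx (Or.inl h), fun x hx u j m hxQ => not_lt.1 fun h =>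
      hx (Or.inr (mem_iUnion.2 ⟨u, hU u j m h hxQ⟩))⟩
  rw [← ENNReal.mul_le_mul_iff_right (two_ne_zero : (2 : ℝ≥0∞) ≠ 0) ENNReal.ofNat_ne_top]
  calc 2 * (2 ^ (d + 2) * volume (Ω₁ ∪ ⋃ u, U u))
      = 2 ^ (d + 3) * volume (Ω₁ ∪ ⋃ u, U u) := by ring
    _ ≤ 2 ^ (d + 3) * (volume Ω₁ + volume (⋃ u, U u)) := by
        gcongr
        exact measure_union_le _ _
    _ ≤ V + V := by
        rw [mul_add]
        exact add_le_add hv1 hv2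
    _ = 2 * V := (two_mul V).symm

/-- The constant in the comparison of two localizations of `T f`. -/
noncomputable def comparisonConst (d : ℕ) (α A B : ℝ) : ℝ≥0∞ :=
  2 * (ENNReal.ofReal B * (ENNReal.ofReal (2 ^ d * (1 - 2 ^ (-α))⁻¹) * 12 ^ d)) +
    (ENNReal.ofReal A + 1) * (4 * (weakTypeConst d α B * (12 ^ d * ENNReal.ofReal ((4 * d) ^ d))))

/-- Comparison of `T F` with the operator applied to the localization of `F` to the ball around
a cube, provided that the maximal functions of `F` are controlled on part of the cube. -/
theorem IsCalderonZygmund.ae_enorm_le_add_local (hd : 0 < d) (hp : p ≠ ∞) (hα : 0 < α)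
    (hA : 0 < A) (hB : 0 ≤ B) (hT : IsCalderonZygmund α A B T) (hf : IsBddCompactlySupported f)
    {u : Fin d → Fin 3} {k : ℤ × (Fin d → ℤ)} {Ω : Set (EuclideanSpace ℝ (Fin d))}
    {N M : ℝ≥0∞} (hM0 : M ≠ 0) (hMt : M ≠ ∞)
    (hvol : 2 * volume (Ω ∩ dyadicCube u k.1 k.2) ≤ volume (dyadicCube u k.1 k.2))
    (hN : ∀ x, x ∉ Ω → ‖T ((hf.memLp p).toLp f) x‖ₑ ≤ N)
    (hM : ∀ x, x ∉ Ω → ∀ u j m, x ∈ dyadicCube u j m →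
        ∫⁻ y in dyadicCube u j m, ‖f y‖ₑ ≤ M * volume (dyadicCube u j m)) :
    ∀ᵐ x, x ∈ dyadicCube u k.1 k.2 → ‖T ((hf.memLp p).toLp f) x‖ₑ ≤
      (comparisonConst d α A B * M + N) +
      ‖T (((hf.indicator (measurableSet_dyadicBall u k)).memLp p).toLp _) x‖ₑ := by
  set Q := dyadicCube u k.1 k.2 with hQ
  set c := dyadicCorner u k.1 k.2 with hc
  set r := dyadicRadius d k.1 with hr
  have hr0 : 0 < r := dyadicRadius_pos hd k.1
  have hQ0 : volume Q ≠ 0 := volume_dyadicCube_ne_zero u k.1 k.2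
  have hQt : volume Q ≠ ∞ := volume_dyadicCube_ne_top u k.1 k.2
  have hQc : Q ⊆ closedBall c r := dyadicCube_subset_closedBall (dyadicCorner_mem u k.1 k.2)
  -- The set `Ω` fills at most half of `Q`, so `Q` contains a point outside it. A large ball around
  -- `Q` fits in a cube of some system with side at most `12ρ`, and this cube contains that point.
  have hball : ∀ ρ, 4 * r ≤ ρ →
      ∫⁻ y in closedBall c ρ, ‖f y‖ₑ ≤ M * 12 ^ d * ENNReal.ofReal (ρ ^ d) := by
    intro ρ hρ
    have hρ0 : 0 < ρ := by linarith
    obtain ⟨x, hxQ, hxΩ⟩ : ∃ x ∈ Q, x ∉ Ω := by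
      by_contra! h
      rw [inter_eq_right.2 h, two_mul] at hvol
      exact (ENNReal.lt_add_right hQt hQ0).not_ge hvol
    obtain ⟨v, j, m, hsub, hside⟩ := exists_dyadicCube_superset_closedBall' c hρ0
    refine (lintegral_mono_set hsub).trans ((hM x hxΩ v j m (hsub
      (closedBall_subset_closedBall (by linarith) (hQc hxQ)))).trans ?_)
    rw [mul_assoc, volume_dyadicCube]
    gcongr
    have h12 : (12 : ℝ≥0∞) ^ d = ENNReal.ofReal (12 ^ d) := by
      rw [ENNReal.ofReal_pow (by norm_num), ENNReal.ofReal_ofNat]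
    rw [h12, ← ENNReal.ofReal_mul (by positivity), ← mul_pow]
    exact ENNReal.ofReal_le_ofReal (pow_le_pow_left₀ (by positivity) hside d)
  set g := (dyadicBall u k).indicator f with hg
  have hgb : IsBddCompactlySupported g := hf.indicator (measurableSet_dyadicBall u k)
  set h := f - g with hh
  have hhb : IsBddCompactlySupported h := hf.sub hgb
  have hh0 : ∀ y ∈ closedBall c (4 * r), h y = 0 := by
    intro y hy
    rw [hh, Pi.sub_apply, hg, indicator_of_mem (by exact hy), sub_self]
  have hhf : ∀ y, ‖h y‖ₑ ≤ ‖f y‖ₑ := by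
    intro y
    by_cases hy : y ∈ dyadicBall u k
    · rw [hh0 y hy]; simp
    · rw [hh, Pi.sub_apply, hg, indicator_of_notMem hy, sub_zero]
  obtain ⟨e, he⟩ := hT.exists_ae_enorm_sub_le hα hB (by positivity : 0 < 4 * r) hhb hh0
  set Z := ENNReal.ofReal B *
    (ENNReal.ofReal (2 ^ d * (1 - 2 ^ (-α))⁻¹) * (M * 12 ^ d)) with hZ
  have htail : ENNReal.ofReal B * ∫⁻ y in (closedBall c (4 * r))ᶜ,
      kernelWeight α c (4 * r) y * ‖h y‖ₑ ≤ Z := by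
    rw [hZ]
    gcongr
    exact lintegral_tail_le hα c (by positivity) hhb.aestronglyMeasurable.enorm fun ρ hρ =>
      (lintegral_mono fun y => hhf y).trans (hball ρ hρ)
  have hW0 := weakTypeConst_ne_zero d α B
  have hWt := weakTypeConst_ne_top d α B
  have hg1 : ∫⁻ y, ‖g y‖ₑ ≤ M * (12 ^ d * ENNReal.ofReal ((4 * d) ^ d)) * volume Q := by
    calc ∫⁻ y, ‖g y‖ₑ = ∫⁻ y in dyadicBall u k, ‖f y‖ₑ := by
          rw [← lintegral_indicator (measurableSet_dyadicBall u k)]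
          exact lintegral_congr fun y => enorm_indicator_eq_indicator_enorm _ _
      _ ≤ M * 12 ^ d * ENNReal.ofReal ((4 * r) ^ d) := hball _ le_rfl
      _ = _ := by
          rw [hQ, volume_dyadicCube, hr, dyadicRadius, ← mul_assoc 4, mul_pow (4 * (d : ℝ)),
            ENNReal.ofReal_mul (by positivity)]
          ring
  set a := weakTypeConst d α B * (M * (12 ^ d * ENNReal.ofReal ((4 * d) ^ d))) with ha
  have hpos : (0 : ℝ) < (4 * d) ^ d := by positivity
  have ha0 : a ≠ 0 := mul_ne_zero hW0 (mul_ne_zero hM0 (mul_ne_zero (by positivity)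
    (ENNReal.ofReal_pos.2 hpos).ne'))
  have hat : a ≠ ∞ := by rw [ha]; finiteness
  -- The level `4 * a` is chosen so that the set where the local part is large fills at most a
  -- quarter of `Q`.
  have hweak := hT.weak_type hd hp hα hA hB hgb (τ := 4 * a) (mul_ne_zero four_ne_zero ha0)
    (ENNReal.mul_ne_top ENNReal.ofNat_ne_top hat)
  set G := {x | (ENNReal.ofReal A + 1) * (4 * a) < ‖T ((hgb.memLp p).toLp g) x‖ₑ} with hG
  have hGv : 4 * volume G ≤ volume Q := by
    refine mul_le_of_mul_mul_le ha0 hat (hweak.trans ?_)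
    rw [ha, mul_assoc]
    gcongr
  have hTsub : ∀ᵐ x, T ((hf.memLp p).toLp f) x =
      T ((hgb.memLp p).toLp g) x + T ((hhb.memLp p).toLp h) x := by
    have h1 : (hf.memLp p).toLp f = (hgb.memLp p).toLp g + (hhb.memLp p).toLp h := by
      rw [← MemLp.toLp_add]
      congr 1
      rw [hh, add_sub_cancel]
    filter_upwards [Lp.coeFn_add (T ((hgb.memLp p).toLp g)) (T ((hhb.memLp p).toLp h))] with x hx
    rw [h1, map_add, hx, Pi.add_apply]
  have hboth : ∀ᵐ x, T ((hf.memLp p).toLp f) x =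
      T ((hgb.memLp p).toLp g) x + T ((hhb.memLp p).toLp h) x ∧
      (x ∈ Q → ‖T ((hhb.memLp p).toLp h) x - e‖ₑ ≤ Z) := by
    filter_upwards [hTsub, he] with x h1 h2
    refine ⟨h1, fun hxQ => (h2 ?_).trans htail⟩
    rw [mul_div_cancel_left₀ _ (by norm_num)]
    exact hQc hxQ
  -- The sets `Ω` and `G` cover at most `1/2 + 1/4` of `Q`, so a point outside both exists at which
  -- the almost everywhere relations also hold.
  obtain ⟨x', hx'Q, hx'Ω, hx'G, hx'1, hx'2⟩ : ∃ x ∈ Q, x ∉ Ω ∧ x ∉ G ∧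
      T ((hf.memLp p).toLp f) x = T ((hgb.memLp p).toLp g) x + T ((hhb.memLp p).toLp h) x ∧
      (x ∈ Q → ‖T ((hhb.memLp p).toLp h) x - e‖ₑ ≤ Z) := by
    by_contra! hcon
    have hle : volume Q ≤ volume (Ω ∩ Q) + volume G := by
      refine le_trans (measure_mono_ae ?_) (measure_union_le _ _)
      filter_upwards [hboth] with x hx hxQ
      by_contra hxU
      have hxQ' : x ∈ Q := hxQ
      have h1 := hcon x hxQ' (fun h => hxU (Or.inl ⟨h, hxQ'⟩)) (fun h => hxU (Or.inr h)) hx.1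
      exact h1.2.not_ge (hx.2 hxQ')
    have h4 : 4 * volume Q ≤ 3 * volume Q := by
      calc 4 * volume Q ≤ 4 * (volume (Ω ∩ Q) + volume G) := by gcongr
        _ = 2 * (2 * volume (Ω ∩ Q)) + 4 * volume G := by ring
        _ ≤ 2 * volume Q + volume Q := by gcongr
        _ = 3 * volume Q := by ring
    have h5 : (4 : ℝ≥0∞) ≤ 3 := by
      rwa [mul_comm 4, mul_comm 3, ENNReal.mul_le_mul_iff_right hQ0 hQt] at h4
    norm_num at h5
  -- At `x'` both `T f` and `T g` are controlled, hence so is `T h`. Since `T h` is nearly equal to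
  -- `e` on `Q`, this one point bounds `e`, and therefore `T h` on the whole cube.
  have hTh : ‖T ((hhb.memLp p).toLp h) x'‖ₑ ≤ N + (ENNReal.ofReal A + 1) * (4 * a) := by
    rw [← add_sub_cancel_left (T ((hgb.memLp p).toLp g) x') (T ((hhb.memLp p).toLp h) x'), ← hx'1]
    exact enorm_sub_le.trans (add_le_add (hN x' hx'Ω) (not_lt.1 hx'G))
  have hE : ‖e‖ₑ ≤ Z + (N + (ENNReal.ofReal A + 1) * (4 * a)) := by
    calc ‖e‖ₑ = ‖T ((hhb.memLp p).toLp h) x' - (T ((hhb.memLp p).toLp h) x' - e)‖ₑ := by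
          rw [sub_sub_cancel]
      _ ≤ _ := enorm_sub_le
      _ ≤ _ := by
          rw [add_comm]
          exact add_le_add (hx'2 hx'Q) hTh
  filter_upwards [hboth] with x hx hxQ
  rw [hx.1]
  calc ‖T ((hgb.memLp p).toLp g) x + T ((hhb.memLp p).toLp h) x‖ₑ
      = ‖T ((hgb.memLp p).toLp g) x + ((T ((hhb.memLp p).toLp h) x - e) + e)‖ₑ := by
        rw [sub_add_cancel]
    _ ≤ ‖T ((hgb.memLp p).toLp g) x‖ₑ + (Z + (Z + (N + (ENNReal.ofReal A + 1) * (4 * a)))) := by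
        refine (enorm_add_le _ _).trans ?_
        gcongr
        exact (enorm_add_le _ _).trans (add_le_add (hx.2 hxQ) hE)
    _ = _ := by
        rw [comparisonConst, hZ, ha]
        ring

/-- The constant in the local step. -/
noncomputable def localConst (d : ℕ) (α A B : ℝ) : ℝ≥0∞ :=
  comparisonConst d α A B * (3 ^ d * 2 ^ (d + 3)) +
    (ENNReal.ofReal A + 1) * (2 ^ (d + 3) * weakTypeConst d α B)

theorem localConst_ne_top (d : ℕ) (α A B : ℝ) : localConst d α A B ≠ ∞ := by
  have := weakTypeConst_ne_top d α B
  unfold localConst comparisonConst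
  finiteness

/-- The children are the stopping cubes of the exceptional set of the localized function. Off the
children that set is negligible and the average bounds the operator; on a child the comparison of
localizations passes the remainder to the next step. -/
theorem IsCalderonZygmund.local_step (hd : 0 < d) (hp : p ≠ ∞) (hα : 0 < α)
    (hA : 0 < A) (hB : 0 ≤ B) (hT : IsCalderonZygmund α A B T) (hf : IsBddCompactlySupported f)
    (u : Fin d → Fin 3) (i : ℤ × (Fin d → ℤ)) :
    ∃ C : Set (ℤ × (Fin d → ℤ)), (C.PairwiseDisjoint fun k => dyadicCube u k.1 k.2) ∧
      (∀ k ∈ C, i.1 < k.1 ∧ dyadicCube u k.1 k.2 ⊆ dyadicCube u i.1 i.2) ∧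
      2 * ∑' k : C, volume (dyadicCube u k.1.1 k.1.2) ≤ volume (dyadicCube u i.1 i.2) ∧
      ∀ᵐ x, x ∈ dyadicCube u i.1 i.2 →
        ((∀ k ∈ C, x ∉ dyadicCube u k.1 k.2) →
          ‖T (((hf.indicator (measurableSet_dyadicBall u i)).memLp p).toLp _) x‖ₑ ≤
            localConst d α A B * ballAverage f u i) ∧
        ∀ k ∈ C, x ∈ dyadicCube u k.1 k.2 →
          ‖T (((hf.indicator (measurableSet_dyadicBall u i)).memLp p).toLp _) x‖ₑ ≤
            localConst d α A B * ballAverage f u i +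
            ‖T (((hf.indicator (measurableSet_dyadicBall u k)).memLp p).toLp _) x‖ₑ := by
  set F := (dyadicBall u i).indicator f with hF
  have hFb : IsBddCompactlySupported F := hf.indicator (measurableSet_dyadicBall u i)
  have hQ0 := volume_dyadicCube_ne_zero u i.1 i.2
  have hQt := volume_dyadicCube_ne_top u i.1 i.2
  have hF1 : ∫⁻ y, ‖F y‖ₑ = ballAverage f u i * volume (dyadicCube u i.1 i.2) := by
    rw [ballAverage, ENNReal.div_mul_cancel hQ0 hQt,
      ← lintegral_indicator (measurableSet_dyadicBall u i)]
    exact lintegral_congr fun y => enorm_indicator_eq_indicator_enorm _ _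
  by_cases hL : ballAverage f u i = 0
  -- A vanishing average cannot serve as a level for the weak type bounds, but then the localized
  -- function is zero and no children are needed.
  · refine ⟨∅, pairwiseDisjoint_empty, by simp, by simp, ?_⟩
    rw [hL, zero_mul, lintegral_eq_zero_iff' hFb.aestronglyMeasurable.enorm] at hF1
    have h0 : (hFb.memLp p).toLp F = 0 := by
      refine (Lp.eq_zero_iff_ae_eq_zero).2 ((hFb.memLp p).coeFn_toLp.trans ?_)
      filter_upwards [hF1] with x hx
      simpa using hx
    filter_upwards [Lp.coeFn_zero E p (volume : Measure (EuclideanSpace ℝ (Fin d)))] with x hx _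
    rw [h0, map_zero, hx]
    simp
  have hLt : ballAverage f u i ≠ ∞ := by
    intro h
    rw [h, ENNReal.top_mul hQ0] at hF1
    exact hFb.integrable.2.ne hF1
  obtain ⟨Ω, hΩm, hΩv, hΩ1, hΩ2⟩ :=
    hT.exists_exceptional_set hd hp hα hA hB hFb hL hLt hF1.le
  obtain ⟨C, hC1, hC2, hC3, hC4, hC5⟩ := exists_stopping_of_small_set hd u i hΩm hΩv
  refine ⟨C, hC1, hC2, hC3, ?_⟩
  have hcomp : ∀ᵐ x, ∀ k : C, x ∈ dyadicCube u k.1.1 k.1.2 →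
      ‖T ((hFb.memLp p).toLp F) x‖ₑ ≤ localConst d α A B * ballAverage f u i +
        ‖T (((hf.indicator (measurableSet_dyadicBall u k.1)).memLp p).toLp _) x‖ₑ := by
    refine ae_all_iff.2 fun k => ?_
    have h := hT.ae_enorm_le_add_local hd hp hα hA hB hFb (k := k.1)
      (M := 3 ^ d * 2 ^ (d + 3) * ballAverage f u i) (by simp [hL]) (by finiteness)
      (hC4 k k.2) hΩ1 hΩ2
    have hind : (dyadicBall u k.1).indicator F = (dyadicBall u k.1).indicator f := by
      rw [hF, indicator_indicator, inter_eq_left.2 (dyadicBall_subset (hC2 k k.2).1 (hC2 k k.2).2)]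
    filter_upwards [h] with x hx hxk
    refine (hx hxk).trans_eq ?_
    simp only [hind]
    rw [localConst]
    ring
  filter_upwards [hC5, hcomp] with x h5 hx hxQ
  refine ⟨fun hxC => (hΩ1 x (h5 hxQ hxC)).trans ?_, fun k hk => hx ⟨k, hk⟩⟩
  rw [localConst, add_mul _ _ (ballAverage f u i), ← mul_assoc]
  exact le_add_self

end Operator

/-! ### Iterated selections of cubes -/

/-- A rule that selects, in each cube of `𝒟^u`, disjoint strictly smaller subcubes of at most half
the total measure. -/
structure IsSelection {d : ℕ} (u : Fin d → Fin 3)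
    (ch : ℤ × (Fin d → ℤ) → Set (ℤ × (Fin d → ℤ))) : Prop where
  disjoint : ∀ i, (ch i).PairwiseDisjoint fun k => dyadicCube u k.1 k.2
  lt : ∀ i, ∀ k ∈ ch i, i.1 < k.1
  subset : ∀ i, ∀ k ∈ ch i, dyadicCube u k.1 k.2 ⊆ dyadicCube u i.1 i.2
  volume_le : ∀ i, 2 * ∑' k : ch i, volume (dyadicCube u k.1.1 k.1.2) ≤
    volume (dyadicCube u i.1 i.2)

/-- The `n`-th generation of cubes selected from `r`. -/
def selectionLayer {ι : Type*} (ch : ι → Set ι) (r : ι) : ℕ → Set ι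
  | 0 => {r}
  | n + 1 => ⋃ i ∈ selectionLayer ch r n, ch i

/-- All cubes selected from `r`, in any number of steps. -/
def selectionFamily {ι : Type*} (ch : ι → Set ι) (r : ι) : Set ι :=
  ⋃ n, selectionLayer ch r n

/-- The part of a cube that is not covered by its selected subcubes. -/
def selectionCore {d : ℕ} (u : Fin d → Fin 3) (ch : ℤ × (Fin d → ℤ) → Set (ℤ × (Fin d → ℤ)))
    (i : ℤ × (Fin d → ℤ)) : Set (EuclideanSpace ℝ (Fin d)) :=
  dyadicCube u i.1 i.2 \ ⋃ k ∈ ch i, dyadicCube u k.1 k.2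

section Selection

variable {d : ℕ} {u : Fin d → Fin 3} {ch : ℤ × (Fin d → ℤ) → Set (ℤ × (Fin d → ℤ))}

theorem mem_selectionLayer_succ {ι : Type*} {ch : ι → Set ι} {r k : ι} {n : ℕ} :
    k ∈ selectionLayer ch r (n + 1) ↔ ∃ i ∈ selectionLayer ch r n, k ∈ ch i := by
  simp [selectionLayer]

theorem measurableSet_selectionCore (u : Fin d → Fin 3)
    (ch : ℤ × (Fin d → ℤ) → Set (ℤ × (Fin d → ℤ))) (i : ℤ × (Fin d → ℤ)) :
    MeasurableSet (selectionCore u ch i) :=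
  (measurableSet_dyadicCube u i.1 i.2).diff
    (MeasurableSet.biUnion (to_countable _) fun k _ => measurableSet_dyadicCube u k.1 k.2)

theorem IsSelection.volume_le_core (h : IsSelection u ch) (i : ℤ × (Fin d → ℤ)) :
    volume (dyadicCube u i.1 i.2) ≤ 2 * volume (selectionCore u ch i) := by
  set V := volume (⋃ k ∈ ch i, dyadicCube u k.1 k.2) with hV
  have h1 : 2 * V ≤ volume (dyadicCube u i.1 i.2) := by
    refine le_trans ?_ (h.volume_le i)
    gcongr
    exact measure_biUnion_le _ (to_countable _) _
  have h2 : volume (dyadicCube u i.1 i.2) ≤ volume (selectionCore u ch i) + V := by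
    refine le_trans (measure_mono fun x hx => ?_) (measure_union_le _ _)
    by_cases hxU : x ∈ ⋃ k ∈ ch i, dyadicCube u k.1 k.2
    · exact Or.inr hxU
    · exact Or.inl ⟨hx, hxU⟩
  have hQt := volume_dyadicCube_ne_top u i.1 i.2
  refine (ENNReal.add_le_add_iff_right hQt).1 ?_
  calc volume (dyadicCube u i.1 i.2) + volume (dyadicCube u i.1 i.2)
      = 2 * volume (dyadicCube u i.1 i.2) := (two_mul _).symm
    _ ≤ 2 * (volume (selectionCore u ch i) + V) := by gcongr
    _ = 2 * volume (selectionCore u ch i) + 2 * V := mul_add _ _ _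
    _ ≤ _ := by gcongr

theorem IsSelection.disjoint_layer (h : IsSelection u ch) (r : ℤ × (Fin d → ℤ)) (n : ℕ) :
    (selectionLayer ch r n).PairwiseDisjoint fun k => dyadicCube u k.1 k.2 := by
  induction n with
  | zero => exact pairwiseDisjoint_singleton _ _
  | succ n ih =>
    intro k hk k' hk' hne
    obtain ⟨i, hi, hki⟩ := mem_selectionLayer_succ.1 hk
    obtain ⟨i', hi', hki'⟩ := mem_selectionLayer_succ.1 hk'
    by_cases hii : i = i'
    · subst hii
      exact h.disjoint i hki hki' hne
    · exact (ih hi hi' hii).mono (h.subset i k hki) (h.subset i' k' hki')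

theorem IsSelection.exists_ancestor (h : IsSelection u ch) (r : ℤ × (Fin d → ℤ)) (n m : ℕ)
    {k : ℤ × (Fin d → ℤ)} (hk : k ∈ selectionLayer ch r (n + m)) :
    ∃ i ∈ selectionLayer ch r n, dyadicCube u k.1 k.2 ⊆ dyadicCube u i.1 i.2 := by
  induction m generalizing k with
  | zero => exact ⟨k, hk, Subset.rfl⟩
  | succ m ih =>
    obtain ⟨k', hk', hkk⟩ := mem_selectionLayer_succ.1 hk
    obtain ⟨i, hi, hsub⟩ := ih hk'
    exact ⟨i, hi, (h.subset k' k hkk).trans hsub⟩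

/-- Two selected cubes in the same layer are disjoint. If one lies in a later layer, it is inside a
child of the other, and children are removed from the core, or else inside a cube disjoint from the
other. -/
theorem IsSelection.disjoint_core (h : IsSelection u ch) (r : ℤ × (Fin d → ℤ))
    {i k : ℤ × (Fin d → ℤ)} (hi : i ∈ selectionFamily ch r) (hk : k ∈ selectionFamily ch r)
    (hne : i ≠ k) : Disjoint (selectionCore u ch i) (selectionCore u ch k) := by
  have aux : ∀ n m, ∀ i k, i ≠ k → i ∈ selectionLayer ch r n → k ∈ selectionLayer ch r (n + m) →
      Disjoint (selectionCore u ch i) (selectionCore u ch k) := by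
    intro n m i k hne hi hk
    rcases m with _ | m
    · exact (h.disjoint_layer r n hi hk hne).mono sdiff_subset sdiff_subset
    · rw [show n + (m + 1) = n + 1 + m by ring] at hk
      obtain ⟨k', hk', hsub⟩ := h.exists_ancestor r (n + 1) m hk
      obtain ⟨i', hi', hki'⟩ := mem_selectionLayer_succ.1 hk'
      by_cases hii : i = i'
      · subst hii
        refine disjoint_left.2 fun x hx hx' => hx.2 ?_
        exact mem_biUnion hki' (hsub hx'.1)
      · exact (h.disjoint_layer r n hi hi' hii).mono sdiff_subset
          (sdiff_subset.trans (hsub.trans (h.subset i' k' hki')))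
  obtain ⟨n, hn⟩ := mem_iUnion.1 hi
  obtain ⟨m, hm⟩ := mem_iUnion.1 hk
  rcases le_total n m with hnm | hnm
  · obtain ⟨l, rfl⟩ := Nat.exists_eq_add_of_le hnm
    exact aux n l i k hne hn hm
  · obtain ⟨l, rfl⟩ := Nat.exists_eq_add_of_le hnm
    exact (aux m l k i hne.symm hm hn).symm

theorem IsSelection.two_mul_volume_layer_succ_le (h : IsSelection u ch) (r : ℤ × (Fin d → ℤ))
    (n : ℕ) : 2 * volume (⋃ k ∈ selectionLayer ch r (n + 1), dyadicCube u k.1 k.2) ≤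
      volume (⋃ k ∈ selectionLayer ch r n, dyadicCube u k.1 k.2) := by
  rw [measure_biUnion (to_countable _) (h.disjoint_layer r n)
    fun k _ => measurableSet_dyadicCube u k.1 k.2]
  have hsub : (⋃ k ∈ selectionLayer ch r (n + 1), dyadicCube u k.1 k.2) ⊆
      ⋃ i ∈ selectionLayer ch r n, ⋃ k ∈ ch i, dyadicCube u k.1 k.2 := by
    refine iUnion₂_subset fun k hk => ?_
    obtain ⟨i, hi, hki⟩ := mem_selectionLayer_succ.1 hk
    exact fun x hx => mem_biUnion hi (mem_biUnion hki hx)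
  calc 2 * volume (⋃ k ∈ selectionLayer ch r (n + 1), dyadicCube u k.1 k.2)
      ≤ 2 * ∑' i : selectionLayer ch r n, volume (⋃ k ∈ ch i, dyadicCube u k.1 k.2) := by
        gcongr
        exact (measure_mono hsub).trans (measure_biUnion_le _ (to_countable _) _)
    _ = ∑' i : selectionLayer ch r n, 2 * volume (⋃ k ∈ ch i, dyadicCube u k.1 k.2) :=
        ENNReal.tsum_mul_left.symm
    _ ≤ ∑' i : selectionLayer ch r n, volume (dyadicCube u i.1.1 i.1.2) := by
        refine ENNReal.tsum_le_tsum fun i => le_trans ?_ (h.volume_le i)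
        gcongr
        exact measure_biUnion_le _ (to_countable _) _

/-- Each layer has at most half the measure of the previous one, so the points lying in all layers
form a null set. This makes the recursion terminate at almost every point. -/
theorem IsSelection.ae_exists_notMem_layer (h : IsSelection u ch) (r : ℤ × (Fin d → ℤ)) :
    ∀ᵐ x, ∃ n, ∀ k ∈ selectionLayer ch r n, x ∉ dyadicCube u k.1 k.2 := by
  set V : ℕ → ℝ≥0∞ := fun n => volume (⋃ k ∈ selectionLayer ch r n, dyadicCube u k.1 k.2) with hV
  have h1 : ∀ n, V n ≤ 2⁻¹ ^ n * volume (dyadicCube u r.1 r.2) := by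
    intro n
    induction n with
    | zero => simp [hV, selectionLayer]
    | succ n ih =>
      have h2 := (h.two_mul_volume_layer_succ_le r n).trans ih
      rw [mul_comm, ← ENNReal.le_div_iff_mul_le (Or.inl two_ne_zero)
        (Or.inl ENNReal.ofNat_ne_top)] at h2
      refine h2.trans_eq ?_
      rw [pow_succ, div_eq_mul_inv]
      ring
  have h0 : Tendsto (fun n : ℕ => (2⁻¹ : ℝ≥0∞) ^ n * volume (dyadicCube u r.1 r.2)) atTop
      (𝓝 0) := by
    have h2 := ENNReal.Tendsto.mul_const (ENNReal.tendsto_pow_atTop_nhds_zero_of_lt_one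
      (ENNReal.inv_lt_one.2 ENNReal.one_lt_two)) (Or.inr (volume_dyadicCube_ne_top u r.1 r.2))
    rwa [zero_mul] at h2
  rw [ae_iff]
  refine le_antisymm (ge_of_tendsto' h0 fun n => le_trans (measure_mono fun x hx => ?_) (h1 n))
    zero_le
  rw [mem_ofPred_eq] at hx
  push Not at hx
  obtain ⟨k, hk, hxk⟩ := hx n
  exact mem_biUnion hk hxk

/-- Summation of a recursive bound along the selected cubes that contain a given point. -/
theorem IsSelection.le_tsum_of_recursive_bound (h : IsSelection u ch) (r : ℤ × (Fin d → ℤ))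
    {x : EuclideanSpace ℝ (Fin d)} (N L : ℤ × (Fin d → ℤ) → ℝ≥0∞)
    (hx : ∃ n, ∀ k ∈ selectionLayer ch r n, x ∉ dyadicCube u k.1 k.2)
    (hleaf : ∀ i, x ∈ dyadicCube u i.1 i.2 → (∀ k ∈ ch i, x ∉ dyadicCube u k.1 k.2) → N i ≤ L i)
    (hstep : ∀ i, x ∈ dyadicCube u i.1 i.2 → ∀ k ∈ ch i, x ∈ dyadicCube u k.1 k.2 →
      N i ≤ L i + N k) (hr : x ∈ dyadicCube u r.1 r.2) :
    N r ≤ ∑' k : {k // k ∈ selectionFamily ch r ∧ x ∈ dyadicCube u k.1 k.2}, L k := by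
  obtain ⟨n, hn⟩ := hx
  -- Selected cubes around `x` of generation at least that of `i`. Children have strictly larger
  -- generation, so `i` itself is missing from the set of its child and no term is counted twice.
  set S : ℤ × (Fin d → ℤ) → Set (ℤ × (Fin d → ℤ)) := fun i =>
    {k | (k ∈ selectionFamily ch r ∧ x ∈ dyadicCube u k.1 k.2) ∧ i.1 ≤ k.1} with hS
  -- Induction on the number `m` of layers left before `x` escapes; for `m = 0` no cube of the layer
  -- contains `x`.
  have key : ∀ m l, l + m = n → ∀ i ∈ selectionLayer ch r l, x ∈ dyadicCube u i.1 i.2 →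
      N i ≤ ∑' k, (S i).indicator L k := by
    intro m
    induction m with
    | zero =>
      rintro l rfl i hi hxi
      exact absurd hxi (hn i hi)
    | succ m ih =>
      intro l hl i hi hxi
      have hiS : i ∈ S i := ⟨⟨mem_iUnion.2 ⟨l, hi⟩, hxi⟩, le_rfl⟩
      by_cases hc : ∃ k ∈ ch i, x ∈ dyadicCube u k.1 k.2
      · obtain ⟨k, hk, hxk⟩ := hc
        have h1 := ih (l + 1) (by omega) k (mem_selectionLayer_succ.2 ⟨i, hi, hk⟩) hxk
        have hlt := h.lt i k hk
        calc N i ≤ L i + N k := hstep i hxi k hk hxk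
          _ ≤ (∑' k', ({i} : Set (ℤ × (Fin d → ℤ))).indicator L k') +
                ∑' k', (S k).indicator L k' := by
              refine add_le_add ?_ h1
              refine le_trans ?_ (ENNReal.le_tsum i)
              rw [indicator_of_mem (mem_singleton i)]
          _ = ∑' k', (({i} : Set (ℤ × (Fin d → ℤ))).indicator L k' + (S k).indicator L k') :=
              ENNReal.tsum_add.symm
          _ ≤ _ := by
              refine ENNReal.tsum_le_tsum fun k' => ?_
              by_cases hk' : k' = i
              · subst hk'
                have : k' ∉ S k := fun hmem => hlt.not_ge hmem.2
                rw [indicator_of_mem (mem_singleton _), indicator_of_notMem this, add_zero,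
                  indicator_of_mem hiS]
              · rw [indicator_of_notMem (by simpa using hk'), zero_add]
                refine indicator_le_indicator_of_subset ?_ (fun _ => zero_le) k'
                exact fun a ha => ⟨ha.1, hlt.le.trans ha.2⟩
      · push Not at hc
        refine (hleaf i hxi hc).trans (le_trans ?_ (ENNReal.le_tsum i))
        rw [indicator_of_mem hiS]
  have hr0 := key n 0 (by omega) r (mem_singleton r) hr
  refine hr0.trans ?_
  have h2 := tsum_subtype {k | k ∈ selectionFamily ch r ∧ x ∈ dyadicCube u k.1 k.2} L
  refine le_trans ?_ h2.ge
  refine ENNReal.tsum_le_tsum fun k => indicator_le_indicator_of_subset ?_ (fun _ => zero_le) k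
  exact fun a ha => ha.1

end Selection

/-! ### Sparse domination -/

/-- The number of generations between a selected cube and the cube of a translated system that
contains the ball around it. -/
def ancestorGap (d : ℕ) : ℕ := 5 + d

theorem exists_dyadicCube_superset_dyadicBall {d : ℕ} (u : Fin d → Fin 3)
    (k : ℤ × (Fin d → ℤ)) :
    ∃ v n, dyadicBall u k ⊆ dyadicCube v (k.1 - ancestorGap d) n := by
  refine exists_dyadicCube_superset_closedBall _ _ _ ?_
  have h1 : (2 : ℝ) ^ (-(k.1 - ancestorGap d)) = 2 ^ ancestorGap d * 2 ^ (-k.1) := by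
    rw [neg_sub, sub_eq_add_neg, zpow_add₀ two_ne_zero, zpow_natCast]
  -- The one-third trick requires a side length above six times the radius, and the radius is `4d`
  -- times the side of the selected cube.
  have h2 : (24 * d : ℝ) < 2 ^ ancestorGap d := by
    have : 24 * d < 2 ^ (5 + d) := by
      have := Nat.lt_two_pow_self (n := d)
      rw [pow_add]
      omega
    exact_mod_cast this
  rw [h1, dyadicRadius, ← mul_assoc, ← mul_assoc]
  have : (0 : ℝ) < 2 ^ (-k.1) := by positivity
  gcongr
  linarith

/-- The sparseness parameter. -/
noncomputable def sparseParameter (d : ℕ) : ℝ := (2 * (2 ^ ancestorGap d) ^ d)⁻¹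

theorem sparseParameter_pos (d : ℕ) : 0 < sparseParameter d := by
  unfold sparseParameter; positivity

theorem sparseParameter_lt_one (d : ℕ) : sparseParameter d < 1 := by
  have : (1 : ℝ) ≤ (2 ^ ancestorGap d) ^ d := one_le_pow₀ (one_le_pow₀ one_le_two)
  exact inv_lt_one_of_one_lt₀ (by linarith)

theorem ofReal_sparseParameter_mul (d : ℕ) (x : ℝ≥0∞) :
    ENNReal.ofReal (sparseParameter d) * ((2 ^ ancestorGap d) ^ d * (2 * x)) = x := by
  have h : ENNReal.ofReal (sparseParameter d) = (2 * (2 ^ ancestorGap d) ^ d)⁻¹ := by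
    rw [sparseParameter, ENNReal.ofReal_inv_of_pos (by positivity),
      ENNReal.ofReal_mul zero_le_two, ENNReal.ofReal_pow (by positivity),
      ENNReal.ofReal_pow zero_le_two, ENNReal.ofReal_ofNat]
  rw [h, ← mul_assoc _ 2, mul_comm _ (2 : ℝ≥0∞), ← mul_assoc, ENNReal.inv_mul_cancel, one_mul]
  · positivity
  · finiteness

/-- Pointwise sparse domination of a Calderón-Zygmund operator by the model operators of
complexity zero. -/
theorem IsCalderonZygmund.sparse_domination {d : ℕ} {E : Type*} [NormedAddCommGroup E]
    [NormedSpace ℝ E] [CompleteSpace E] {p : ℝ≥0∞} [Fact (1 ≤ p)] {α A B : ℝ}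
    {T : Lp E p (volume : Measure (EuclideanSpace ℝ (Fin d))) →L[ℝ]
      Lp E p (volume : Measure (EuclideanSpace ℝ (Fin d)))}
    {f : EuclideanSpace ℝ (Fin d) → E} (hd : 0 < d) (hp : p ≠ ∞) (hα : 0 < α)
    (hA : 0 < A) (hB : 0 ≤ B) (hT : IsCalderonZygmund α A B T) (hf : IsBddCompactlySupported f)
    (a : EuclideanSpace ℝ (Fin d)) {l : ℝ} (hl : 0 < l) (hsupp : tsupport f ⊆ closedCube a l) :
    ∃ S : (Fin d → Fin 3) → Set (Set (EuclideanSpace ℝ (Fin d))),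
      (∀ u, S u ⊆ dyadicSystem u ∧ PairwiseNearlyDisjoint (sparseParameter d) (S u)) ∧
      ∀ᵐ x, x ∈ closedCube a l → ‖T ((hf.memLp p).toLp f) x‖ₑ ≤
        localConst d α A B * (2 ^ ancestorGap d) ^ d *
          ∑ u, dyadicModel u (S u) 0 (fun y => ‖f y‖ₑ) x := by
  obtain ⟨u, j, m, hroot⟩ := closedCube_subset_dyadicCube a hl
  set r : ℤ × (Fin d → ℤ) := (j, m) with hr
  choose ch hch1 hch2 hch3 hch4 using hT.local_step hd hp hα hA hB hf u
  have hsel : IsSelection u ch :=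
    ⟨hch1, fun i k hk => (hch2 i k hk).1, fun i k hk => (hch2 i k hk).2, hch3⟩
  choose v n hvn using fun k => exists_dyadicCube_superset_dyadicBall (d := d) u k
  set R : ℤ × (Fin d → ℤ) → Set (EuclideanSpace ℝ (Fin d)) := fun k =>
    dyadicCube (v k) (k.1 - ancestorGap d) (n k) with hR
  have hQR : ∀ k, dyadicCube u k.1 k.2 ⊆ R k := fun k =>
    (dyadicCube_subset_dyadicBall u k).trans (hvn k)
  have hRvol : ∀ k, volume (R k) = (2 ^ ancestorGap d) ^ d * volume (dyadicCube u k.1 k.2) :=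
    fun k => volume_dyadicCube_sub (v k) u k.1 (ancestorGap d) k.2 (n k)
  -- The selected cubes all belong to one system `u`; their enlargements are sorted by the system
  -- that contains them.
  set S : (Fin d → Fin 3) → Set (Set (EuclideanSpace ℝ (Fin d))) := fun w =>
    {Q | ∃ k ∈ selectionFamily ch r, v k = w ∧ R k = Q} with hS
  refine ⟨S, fun w => ⟨?_, ?_, ?_⟩, ?_⟩
  · rintro Q ⟨k, -, rfl, rfl⟩
    exact ⟨_, _, rfl⟩
  · rintro Q ⟨k, -, rfl, rfl⟩
    exact measurableSet_dyadicCube _ _ _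
  -- Several selected cubes may share an enlargement `Q`. One of them is chosen for each `Q`;
  -- distinct `Q` have distinct representatives, whose cores are disjoint.
  · choose! κ hκ1 hκ2 hκ3 using fun (Q : Set (EuclideanSpace ℝ (Fin d))) (hQ : Q ∈ S w) => hQ
    refine ⟨fun Q => selectionCore u ch (κ Q), fun Q hQ => ⟨?_, ?_, ?_⟩, fun Q hQ Q' hQ' hne => ?_⟩
    · exact measurableSet_selectionCore u ch _
    · refine sdiff_subset.trans ((hQR (κ Q)).trans_eq (hκ3 Q hQ))
    · calc ENNReal.ofReal (sparseParameter d) * volume Q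
          = ENNReal.ofReal (sparseParameter d) *
              ((2 ^ ancestorGap d) ^ d * volume (dyadicCube u (κ Q).1 (κ Q).2)) := by
            rw [← hRvol, hκ3 Q hQ]
        _ ≤ ENNReal.ofReal (sparseParameter d) *
              ((2 ^ ancestorGap d) ^ d * (2 * volume (selectionCore u ch (κ Q)))) := by
            gcongr
            exact hsel.volume_le_core _
        _ = _ := ofReal_sparseParameter_mul d _
    · refine disjoint_iff_inter_eq_empty.1 (hsel.disjoint_core r (hκ1 Q hQ) (hκ1 Q' hQ') ?_)
      intro heq
      exact hne (by rw [← hκ3 Q hQ, ← hκ3 Q' hQ', heq])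
  -- The root ball contains the support, so the recursion starts with `T f` itself.
  · have hind : (dyadicBall u r).indicator f = f :=
      indicator_eq_self.2 ((subset_tsupport f).trans (hsupp.trans
        (hroot.trans (dyadicCube_subset_dyadicBall u r))))
    filter_upwards [hsel.ae_exists_notMem_layer r, ae_all_iff.2 hch4] with x hx1 hx2 hxa
    have h1 := hsel.le_tsum_of_recursive_bound r
      (fun i => ‖T (((hf.indicator (measurableSet_dyadicBall u i)).memLp p).toLp _) x‖ₑ)
      (fun i => localConst d α A B * ballAverage f u i) hx1 (fun i hi => (hx2 i hi).1)
      (fun i hi => (hx2 i hi).2) (hroot hxa)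
    simp only [hind] at h1
    refine h1.trans ?_
    rw [ENNReal.tsum_mul_left, mul_assoc]
    gcongr
    have havg : ∀ k, ballAverage f u k ≤ (2 ^ ancestorGap d) ^ d *
        ⨍⁻ y in dyadicAncestor (v k) 0 (R k), ‖f y‖ₑ ∂volume := by
      intro k
      have hanc : dyadicAncestor (v k) 0 (R k) = R k := by
        have := (dyadicAncestor_spec hd (v k) 0 (k.1 - ancestorGap d) (n k) (n k)).2 (by simp)
        simpa using this
      have h20 : ((2 : ℝ≥0∞) ^ ancestorGap d) ^ d ≠ 0 := by positivity
      have h2t : ((2 : ℝ≥0∞) ^ ancestorGap d) ^ d ≠ ∞ := by finiteness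
      rw [hanc, setLAverage_eq, hRvol, ← mul_div_assoc, ENNReal.mul_div_mul_left _ _ h20 h2t,
        ballAverage]
      gcongr
      exact hvn k
    have hsum : ∑' k : {k // k ∈ selectionFamily ch r ∧ x ∈ dyadicCube u k.1 k.2},
        ballAverage f u k ≤ (2 ^ ancestorGap d) ^ d *
          ∑' k : {k // k ∈ selectionFamily ch r ∧ x ∈ dyadicCube u k.1 k.2},
            ⨍⁻ y in dyadicAncestor (v k.1) 0 (R k.1), ‖f y‖ₑ ∂volume := by
      rw [← ENNReal.tsum_mul_left]
      exact ENNReal.tsum_le_tsum fun k => havg k.1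
    refine hsum.trans (mul_le_mul_right ?_ _)
    let ψ : (Σ w, S w) → ℝ≥0∞ := fun q => (q.2 : Set (EuclideanSpace ℝ (Fin d))).indicator
      (fun _ => ⨍⁻ y in dyadicAncestor q.1 0 q.2, ‖f y‖ₑ ∂volume) x
    let φ : {k // k ∈ selectionFamily ch r ∧ x ∈ dyadicCube u k.1 k.2} → Σ w, S w := fun k =>
      ⟨v k.1, ⟨R k.1, k.1, k.2.1, rfl, rfl⟩⟩
    -- Enlargement is injective once `x` is fixed: equal enlargements force equal generations, and
    -- two selected cubes of one generation that contain `x` coincide. Hence no multiplicity is lost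
    -- in passing to sets of cubes.
    have hφinj : Function.Injective φ := by
      rintro ⟨k, hk, hxk⟩ ⟨k', hk', hxk'⟩ heq
      have hpair := congrArg (fun q : (Σ w, S w) =>
        (q.1, (q.2 : Set (EuclideanSpace ℝ (Fin d))))) heq
      obtain ⟨hv, hRR⟩ := Prod.mk.inj hpair
      replace hv : v k = v k' := hv
      replace hRR : dyadicCube (v k) (k.1 - ancestorGap d) (n k) =
        dyadicCube (v k') (k'.1 - ancestorGap d) (n k') := hRR
      rw [← hv] at hRR
      have hg1 := dyadicCube_gen_le hd hRR.le
      have hg2 := dyadicCube_gen_le hd hRR.ge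
      obtain ⟨j1, m1⟩ := k
      obtain ⟨j2, m2⟩ := k'
      have hj : j1 = j2 := by simp only at hg1 hg2; omega
      subst hj
      have hm : m1 = m2 := dyadicCube_index_unique hxk hxk'
      subst hm
      rfl
    calc ∑' k : {k // k ∈ selectionFamily ch r ∧ x ∈ dyadicCube u k.1 k.2},
          ⨍⁻ y in dyadicAncestor (v k.1) 0 (R k.1), ‖f y‖ₑ ∂volume
        = ∑' k, ψ (φ k) := by
          refine tsum_congr fun k => ?_
          simp only [ψ, φ]
          rw [indicator_of_mem (hQR k.1 k.2.2)]
      _ ≤ ∑' q, ψ q := ENNReal.tsum_comp_le_tsum_of_injective hφinj ψ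
      _ = ∑ w, dyadicModel w (S w) 0 (fun y => ‖f y‖ₑ) x := by
          rw [ENNReal.tsum_sigma', tsum_fintype]
          rfl

end DyadicDomination

/-! ### The theorem, from the sparse bound. -/

open DyadicDomination
/-- Pointwise dyadic domination for vector-valued Calderón-Zygmund operators. The parameter `ν`
depends only on the dimension, and `C` only on the dimension, the Hölder exponent `α`, the bound
`A` for the operator norm and the kernel constant `B`. -/
theorem theorem2 (d : ℕ) (hd : 0 < d) :
    ∃ ν : ℝ, 0 < ν ∧ ν < 1 ∧
    ∀ α : ℝ, 0 < α → α ≤ 1 → ∀ A B : ℝ,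
    ∃ C : ℝ, 0 < C ∧
    ∀ (E : Type*) [NormedAddCommGroup E] [NormedSpace ℝ E] [CompleteSpace E]
      (p : ℝ≥0∞) [Fact (1 ≤ p)], 1 < p → p < ∞ →
    ∀ T : Lp E p (volume : Measure (EuclideanSpace ℝ (Fin d))) →L[ℝ]
        Lp E p (volume : Measure (EuclideanSpace ℝ (Fin d))),
      IsCalderonZygmund α A B T →
    ∀ (f : EuclideanSpace ℝ (Fin d) → E) (hf : IsBddCompactlySupported f)
      (a : EuclideanSpace ℝ (Fin d)) (l : ℝ), 0 < l → tsupport f ⊆ closedCube a l →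
    ∃ S : (Fin d → Fin 3) → ℕ → Set (Set (EuclideanSpace ℝ (Fin d))),
      (∀ u k, S u k ⊆ dyadicSystem u ∧ PairwiseNearlyDisjoint ν (S u k)) ∧
      ∀ᵐ x : EuclideanSpace ℝ (Fin d),
        (closedCube a l).indicator (fun y => ‖T ((hf.memLp p).toLp f) y‖ₑ) x ≤
          ENNReal.ofReal C * ∑ u : Fin d → Fin 3, ∑' k : ℕ,
            ENNReal.ofReal ((2 : ℝ) ^ (-α * (k : ℝ))) *
              dyadicModel u (S u k) k (fun y => ‖f y‖ₑ) x := by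
  refine ⟨sparseParameter d, sparseParameter_pos d, sparseParameter_lt_one d, ?_⟩
  intro α hα _ A B
  -- The constants `A` and `B` are arbitrary reals, whereas the sparse bound needs `A > 0` and `B ≥
  -- 0`; enlarging them is harmless.
  set K : ℝ≥0∞ := localConst d α (max A 1) (max B 0) * (2 ^ ancestorGap d) ^ d with hK
  have hKt : K ≠ ∞ := by
    have := localConst_ne_top d α (max A 1) (max B 0)
    rw [hK]
    finiteness
  refine ⟨K.toReal + 1, by positivity, ?_⟩
  intro E _ _ _ p _ _ hp T hT f hf a l hl hsupp
  obtain ⟨S, hS, hdom⟩ := (hT.mono (le_max_left A 1) (le_max_left B 0)).sparse_domination hd hp.ne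
    hα (zero_lt_one.trans_le (le_max_right A 1)) (le_max_right B 0) hf a hl hsupp
  -- The sparse bound `sparse_domination` is stronger: it controls `T f` by the terms with `k = 0`.
  refine ⟨fun u k => if k = 0 then S u else ∅, fun u k => ?_, ?_⟩
  · by_cases hk : k = 0
    · simpa [hk] using hS u
    · simp [hk, PairwiseNearlyDisjoint]
  · filter_upwards [hdom] with x hx
    by_cases hxa : x ∉ closedCube a l
    · rw [indicator_of_notMem hxa]
      exact zero_le
    rw [not_not] at hxa
    rw [indicator_of_mem hxa]
    refine (hx hxa).trans (mul_le_mul' ?_ (Finset.sum_le_sum fun u _ => ?_))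
    · calc K = ENNReal.ofReal K.toReal := (ENNReal.ofReal_toReal hKt).symm
        _ ≤ ENNReal.ofReal (K.toReal + 1) := ENNReal.ofReal_le_ofReal (by linarith)
    · refine le_trans ?_ (ENNReal.le_tsum 0)
      simp
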